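/- Let $s \ge t \ge 2$ be fixed integers. For every $\varepsilon > 0$ there is $d_0 = d_0(s,t,\varepsilon)$ such that the following holds for all $d \ge d_0$. Let $G$ be a (finite or infinite) simple graph that does not contain the complete bipartite graph $K_{s,t}$ as a (not necessarily induced) subgraph and in which every vertex has degree at least $d$. Let $T$ be a finite tree with at most $\frac{1}{64}\, s^{-1/(t-1)}\, d^{t/(t-1)}$ edges and maximum degree at most $\frac{d}{64t}$. For each vertex $v$ of $G$ fix, arbitrarily, a set $N_+(v)$ of exactly $d$ neighbours of $v$; choose an arbitrary root $r$ of $T$ and an arbitrary vertex $x_0$ of $G$. Consider the following randomized algorithm. Start by embedding the root: $f(r) = x_0$. As long as $T$ is not completely embedded, take an arbitrary vertex $u$ of $T$ that is already embedded but whose children are not (the choice of $u$ may depend on the embedding so far). If the number of vertices of $N_+(f(u))$ not occupied by vertices of $T$ is at least the number of children of $u$, embed the children of $u$ one by one (in an arbitrary order), each at a vertex chosen uniformly at random among the vertices of $N_+(f(u))$ that are unoccupied at that moment, and continue. Otherwise, fail. Then, with probability at least $1-\varepsilon$, the algorithm does not fail and its output $f$ is an embedding of $T$ in $G$, that is, an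 injective map $f : V(T) \to V(G)$ that sends edges of $T$ to edges of $G$. -/

import Mathlib

/-! The randomized tree embedding algorithm.  `T` is a finite tree on `W` with root `r`, which is
to be embedded into a graph on `V`; `Nplus v` is the set of neighbours of `v` that was fixed
beforehand. -/

namespace TreeEmbedding

/-- `c` is a child of `u` in `T` rooted at `r`: `u` is the neighbour of `c` that lies on the path
from `r` to `c`. -/
def IsChild {W : Type*} (T : SimpleGraph W) (r u c : W) : Prop :=
  T.Adj u c ∧ ∃ p : T.Walk r c, p.IsPath ∧ u ∈ p.support

/-- A partial map from the tree to the graph: `f w = some v` if `w` is already embedded at `v`,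
and `f w = none` if `w` is not embedded yet. -/
abbrev PartialMap (W V : Type*) := W → Option V

/-- `u` is already embedded but its children are not.  (The algorithm places all the children of a
vertex in the same round.  A vertex without children never qualifies.) -/
def Pending {W V : Type*} (T : SimpleGraph W) (r : W) (f : PartialMap W V) (u : W) : Prop :=
  f u ≠ none ∧ ∃ c, IsChild T r u c ∧ f c = none

/-- The choices that the algorithm leaves open: which embedded vertex with children not yet embedded
is taken next (this may depend on everything that happened so far), and in which order the children
of a vertex are embedded. -/
structure Schedule {W : Type*} (T : SimpleGraph W) (r : W) (V : Type*) where
  next : PartialMap W V → W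
  next_pending : ∀ f, (∃ u, Pending T r f u) → Pending T r f (next f)
  children : W → List W
  children_nodup : ∀ u, (children u).Nodup
  mem_children : ∀ u c, c ∈ children u ↔ IsChild T r u c

open Classical in
/-- The vertices of `Nplus v` that are not occupied by vertices of the tree. -/
noncomputable def available {W V : Type*} (Nplus : V → Finset V) (f : PartialMap W V) (v : V) :
    Finset V :=
  (Nplus v).filter fun x => ∀ w, f w ≠ some x

open Classical in
/-- Embed the vertices of the list one by one, each at a uniformly random vertex among those of
`Nplus v` that are unoccupied at that moment; `none` means failure. -/
noncomputable def embedList {W V : Type*} (Nplus : V → Finset V) (v : V) :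
    List W → PartialMap W V → PMF (Option (PartialMap W V))
  | [], f => PMF.pure (some f)
  | c :: cs, f =>
    if h : (available Nplus f v).Nonempty then
      (PMF.uniformOfFinset (available Nplus f v) h).bind fun x =>
        embedList Nplus v cs (Function.update f c (some x))
    else PMF.pure none

/-- One round: `u` is taken.  If `f u` has enough unoccupied vertices in `Nplus (f u)` for
all the children of `u`, they are embedded there; otherwise the algorithm fails. -/
noncomputable def embedChildren {W V : Type*} {T : SimpleGraph W} {r : W} (σ : Schedule T r V)
    (Nplus : V → Finset V) (u : W) (f : PartialMap W V) : PMF (Option (PartialMap W V)) :=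
  match f u with
  | none => PMF.pure none
  | some v =>
    if (σ.children u).length ≤ (available Nplus f v).card then
      embedList Nplus v (σ.children u) f
    else PMF.pure none

open Classical in
/-- At most `n` rounds, stopping when the whole tree is embedded or when a round fails. -/
noncomputable def rounds {W V : Type*} {T : SimpleGraph W} {r : W} (σ : Schedule T r V)
    (Nplus : V → Finset V) : ℕ → PartialMap W V → PMF (Option (PartialMap W V))
  | 0, f => PMF.pure (some f)
  | n + 1, f =>
    if ∀ w, f w ≠ none then PMF.pure (some f)
    else (embedChildren σ Nplus (σ.next f) f).bind fun o =>
      match o with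
      | none => PMF.pure none
      | some f' => rounds σ Nplus n f'

open Classical in
/-- The law of the output of the algorithm, started with the root `r` at the vertex `x₀`.  Every
successful round embeds at least one new vertex, so `Fintype.card W` rounds are as good as
arbitrarily many. -/
noncomputable def algorithm {W V : Type*} [Fintype W] {T : SimpleGraph W} {r : W}
    (σ : Schedule T r V) (Nplus : V → Finset V) (x₀ : V) : PMF (Option (PartialMap W V)) :=
  rounds σ Nplus (Fintype.card W) (Function.update (fun _ => none) r (some x₀))

/-- The event that the output is an embedding of `T` in `G`: the algorithm did not fail, all of `T`
is embedded, and the resulting map is injective and preserves adjacency. -/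
def Success {W V : Type*} (T : SimpleGraph W) (G : SimpleGraph V) :
    Set (Option (PartialMap W V)) :=
  {o | ∃ g : T.Copy G, o = some fun w => some (g w)}

end TreeEmbedding

open SimpleGraph Finset
open scoped ENNReal

namespace TreeEmbedding

/-! ### Rooted trees and their parent functions -/

section Tree

variable {W : Type*} {T : SimpleGraph W} {r : W}

/-! Write m = t - 1, n for the number of tree vertices, γ = s^(1/m) d^(1-1/m). A hit of v is a tree
vertex placed in N(v) other than as a child of the tree vertex at v. Own children take at most
d/(64t) places of N(v), so no round fails as long as every v has fewer than H = 31d/64 hits. Until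
then at least d/2 places are free at each step, and a child of the tree vertex at p hits v with
probability at most 2 codeg(v,p)/d.

Codegrees are small on average. An m-set in N(v) together with p ∉ S has fewer than s common
neighbours, so for x in N(p) the m-th moment of codeg(v,x) is at most about γ^m and its mean at most
about γ (`sum_choose_le`, `sum_exp_codeg_le`). The bound on the edges of T says that (n-1)γ ≤ d²/64,
so about 4nγ/d ≤ d/16 hits are expected, well below H.

Concentration comes from an exponential supermartingale. The energy of v charges λ for a hit,
b·codeg(v,p) for an unplaced vertex whose parent is at p, and κ = 4bγ for a vertex whose parent is
unplaced. It is at least λ times the number of hits, and its exponential does not grow on average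
(`sum_exp_le`).

G may be infinite, so a union bound over all v is impossible. Only active vertices are counted:
those with t hits, or with codegree at least t to an occupied vertex. One placement activates at
most M = (n^m + d^t)s vertices, all common neighbours of certain t-sets, and each enters with
bounded weight. `potential` adds up the active weights and keeps a reserve for later entries. It is
a supermartingale (`Tame.sum_potential_le`), so failure has probability at most its initial value
divided by exp(λH) (`Tame.algorithm_le`), which `failure_bound_le` shows to be at most ε. -/

theorem IsChild.eq_of_isTree (hT : T.IsTree) {u u' c : W} (h : IsChild T r u c)
    (h' : IsChild T r u' c) : u = u' := by
  classical
  -- Cutting the path at u and appending the edge uc gives a path again, hence the same one.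
  have key : ∀ {u}, T.Adj u c → ∀ p : T.Walk r c, p.IsPath → u ∈ p.support →
      u = p.penultimate := by
    intro u hadj p hp hu
    have hc : c ∉ (p.takeUntil u hu).support :=
      Walk.endpoint_notMem_support_takeUntil hp hu hadj.ne'
    have hq : ((p.takeUntil u hu).concat hadj).IsPath := (hp.takeUntil hu).concat hc hadj
    have : (p.takeUntil u hu).concat hadj = p := (hT.existsUnique_path r c).unique hq hp
    rw [← this, Walk.penultimate_concat]
  obtain ⟨hadj, p, hp, hu⟩ := h
  obtain ⟨hadj', p', hp', hu'⟩ := h'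
  rw [key hadj p hp hu, key hadj' p' hp' hu', (hT.existsUnique_path r c).unique hp hp']

theorem not_isChild_root {u : W} : ¬ IsChild T r u r := by
  rintro ⟨hadj, p, hp, hu⟩
  rw [Walk.isPath_iff_nil] at hp
  cases hp
  simp at hu
  exact hadj.ne hu

theorem exists_isChild (hT : T.IsTree) {c : W} (hc : c ≠ r) : ∃ u, IsChild T r u c := by
  obtain ⟨p, hp, -⟩ := hT.existsUnique_path r c
  have hn : ¬ p.Nil := fun h => hc h.eq.symm
  exact ⟨p.penultimate, p.adj_penultimate hn, p, hp, p.getVert_mem_support _⟩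

theorem isChild_or_isChild (hT : T.IsTree) {a b : W} (h : T.Adj a b) :
    IsChild T r a b ∨ IsChild T r b a := by
  classical
  obtain ⟨p, hp, -⟩ := hT.existsUnique_path r b
  by_cases ha : a ∈ p.support
  · exact Or.inl ⟨h, p, hp, ha⟩
  · exact Or.inr ⟨h.symm, p.concat h.symm, hp.concat ha h.symm, by
      rw [Walk.support_concat]; simp⟩

/-- The children relation of a rooted tree is given by a parent function. -/
theorem exists_parent (hT : T.IsTree) :
    ∃ par : W → W, ∀ u c, IsChild T r u c ↔ c ≠ r ∧ par c = u := by
  classical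
  -- The value at the root is a dummy; this is why c ≠ r accompanies `par` throughout.
  refine ⟨fun c => if h : c ≠ r then (exists_isChild hT h).choose else c, fun u c => ?_⟩
  constructor
  · intro h
    have hc : c ≠ r := by rintro rfl; exact not_isChild_root h
    refine ⟨hc, ?_⟩
    simp only [dif_pos hc]
    exact (exists_isChild hT hc).choose_spec.eq_of_isTree hT h
  · rintro ⟨hc, rfl⟩
    simp only [dif_pos hc]
    exact (exists_isChild hT hc).choose_spec

end Tree

/-! ### Counting common neighbours -/

section CommonNeighbors

variable {V : Type*} {G : SimpleGraph V} {s t : ℕ}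

/-- In a `K_{s,t}`-free graph any `t` vertices have fewer than `s` common neighbours. -/
theorem exists_commonNeighbors (h : (completeBipartiteGraph (Fin s) (Fin t)).Free G)
    {S : Finset V} (hS : S.card = t) :
    ∃ C : Finset V, C.card < s ∧ ∀ v, (∀ y ∈ S, G.Adj v y) → v ∈ C := by
  classical
  have hno : ∀ C : Finset V, C.card = s → ¬ ∀ v ∈ C, ∀ y ∈ S, G.Adj v y := by
    intro C hC hadj
    apply h
    rw [completeBipartiteGraph_isContained_iff]
    exact ⟨C, S, by simpa using hC, by simpa using hS, fun v hv y hy => hadj v hv y hy⟩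
  by_cases hfin : {v | ∀ y ∈ S, G.Adj v y}.Finite
  · refine ⟨hfin.toFinset, ?_, by simp⟩
    by_contra! hle
    obtain ⟨C, hC, hcard⟩ := exists_subset_card_eq hle
    exact hno C hcard fun v hv => by simpa using hC hv
  · obtain ⟨C, hC, hcard⟩ := Set.Infinite.exists_subset_card_eq hfin s
    exact (hno C hcard fun v hv => hC hv).elim

theorem exists_commonNeighbors_biUnion (h : (completeBipartiteGraph (Fin s) (Fin t)).Free G)
    (𝒮 : Finset (Finset V)) (h𝒮 : ∀ S ∈ 𝒮, S.card = t) :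
    ∃ C : Finset V, C.card ≤ 𝒮.card * s ∧ ∀ S ∈ 𝒮, ∀ v, (∀ y ∈ S, G.Adj v y) → v ∈ C := by
  classical
  have : ∀ S : Finset V, ∃ C : Finset V,
      S.card = t → C.card < s ∧ ∀ v, (∀ y ∈ S, G.Adj v y) → v ∈ C := by
    intro S
    by_cases hS : S.card = t
    · obtain ⟨C, hC⟩ := exists_commonNeighbors h hS
      exact ⟨C, fun _ => hC⟩
    · exact ⟨∅, fun h => (hS h).elim⟩
  choose C hC using this
  exact ⟨𝒮.biUnion C, card_biUnion_le_card_mul _ _ _ fun S hS => (hC S (h𝒮 S hS)).1.le,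
    fun S hS v hv => mem_biUnion.2 ⟨S, hS, (hC S (h𝒮 S hS)).2 v hv⟩⟩

open Classical in
/-- The neighbourhoods of the vertices around `p` meet `N v` in few `m`-sets. -/
theorem sum_choose_le {m d : ℕ} (h : (completeBipartiteGraph (Fin s) (Fin (m + 1))).Free G)
    {N : V → Finset V} (hN : ∀ x, (∀ y ∈ N x, G.Adj x y) ∧ (N x).card = d) (v p : V) :
    ∑ x ∈ N p, (((N x ∩ N v).erase p).card).choose m ≤ s * d.choose m := by
  calc ∑ x ∈ N p, (((N x ∩ N v).erase p).card).choose m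
      = ∑ x ∈ N p, (bipartiteAbove (fun x S => S ⊆ (N x ∩ N v).erase p)
          (powersetCard m (N v)) x).card := by
        refine sum_congr rfl fun x _ => ?_
        rw [← card_powersetCard]
        congr 1
        ext S
        simp only [mem_powersetCard, bipartiteAbove, mem_filter]
        constructor
        · rintro ⟨h1, h2⟩
          exact ⟨⟨h1.trans ((erase_subset _ _).trans inter_subset_right), h2⟩, h1⟩
        · rintro ⟨⟨_, h2⟩, h1⟩
          exact ⟨h1, h2⟩
    _ = ∑ S ∈ powersetCard m (N v), (bipartiteBelow (fun x S => S ⊆ (N x ∩ N v).erase p)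
          (N p) S).card := sum_card_bipartiteAbove_eq_sum_card_bipartiteBelow _
    _ ≤ (powersetCard m (N v)).card • s := by
        refine sum_le_card_nsmul _ _ _ fun S hS => ?_
        rw [mem_powersetCard] at hS
        -- Erasing p discards the sets S that contain p. For the others S ∪ {p} has m + 1 elements,
        -- all adjacent to x.
        by_cases hp : p ∈ S
        · rw [card_eq_zero.2]
          · exact Nat.zero_le _
          · refine filter_eq_empty_iff.2 fun x _ hx => ?_
            simpa using hx hp
        · obtain ⟨C, hC, hmem⟩ := exists_commonNeighbors h (S := insert p S)
            (by rw [card_insert_of_notMem hp, hS.2])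
          refine (card_le_card fun x hx => ?_).trans hC.le
          simp only [bipartiteBelow, mem_filter] at hx
          refine hmem x fun y hy => ?_
          rcases mem_insert.1 hy with rfl | hy
          · exact ((hN _).1 x hx.1).symm
          · exact (hN x).1 y (mem_inter.1 (mem_of_mem_erase (hx.2 hy))).1
    _ = s * d.choose m := by
        rw [card_powersetCard, (hN v).2, smul_eq_mul, mul_comm]

end CommonNeighbors

/-! ### Moments of codegrees and the drift of one step -/

section Drift

variable {V : Type*} {G : SimpleGraph V} {s d : ℕ}

open Classical in
/-- The number of chosen neighbours of `p` that are chosen neighbours of `v`, for `p ≠ v`. -/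
noncomputable def codeg (N : V → Finset V) (v p : V) : ℕ :=
  if p = v then 0 else (N p ∩ N v).card

theorem codeg_le {N : V → Finset V} (hN : ∀ x, (N x).card = d) (v p : V) : codeg N v p ≤ d := by
  classical
  unfold codeg
  split_ifs
  · exact Nat.zero_le _
  · exact (card_le_card inter_subset_right).trans (hN v).le

theorem exp_sub_one_le_of_le {z δ : ℝ} (hz : 0 ≤ z) (hδ : z ≤ δ) (hδ1 : δ ≤ 1) :
    Real.exp z - 1 ≤ (1 + δ) * z := by
  have h := Real.abs_exp_sub_one_sub_id_le (x := z) (by rw [abs_of_nonneg hz]; linarith)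
  have := (abs_le.1 h).2
  nlinarith

theorem exp_mul_sub_one_le {τ z : ℝ} (h0 : 0 ≤ τ) (h1 : τ ≤ 1) :
    Real.exp (τ * z) - 1 ≤ τ * (Real.exp z - 1) := by
  have := convexOn_exp.2 (Set.mem_univ z) (Set.mem_univ 0) h0 (sub_nonneg.2 h1) (by ring)
  simp only [smul_eq_mul, mul_zero, add_zero, Real.exp_zero, mul_one] at this
  linarith

/-- The truncated codegrees around `p` have small `m`-th moment. -/
theorem sum_pow_le {m : ℕ} (h : (completeBipartiteGraph (Fin s) (Fin (m + 1))).Free G)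
    {N : V → Finset V} (hN : ∀ x, (∀ y ∈ N x, G.Adj x y) ∧ (N x).card = d) (v p : V) :
    ∑ x ∈ N p, (codeg N v x - m) ^ m ≤ s * d ^ m := by
  classical
  calc ∑ x ∈ N p, (codeg N v x - m) ^ m
      ≤ ∑ x ∈ N p, (((N x ∩ N v).erase p).card).descFactorial m := by
        refine sum_le_sum fun x _ => le_trans ?_ (Nat.pow_sub_le_descFactorial _ _)
        refine Nat.pow_le_pow_left (Nat.sub_le_sub_right ?_ _) _
        unfold codeg
        split_ifs
        · exact Nat.zero_le _
        · have := pred_card_le_card_erase (s := N x ∩ N v) (a := p)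
          omega
    _ = m.factorial * ∑ x ∈ N p, (((N x ∩ N v).erase p).card).choose m := by
        simp_rw [Nat.descFactorial_eq_factorial_mul_choose, mul_sum]
    _ ≤ m.factorial * (s * d.choose m) := Nat.mul_le_mul_left _ (sum_choose_le h hN v p)
    _ = s * d.descFactorial m := by rw [Nat.descFactorial_eq_factorial_mul_choose]; ring
    _ ≤ s * d ^ m := Nat.mul_le_mul_left _ (Nat.descFactorial_le_pow _ _)

/-- The pointwise bound behind `sum_exp_codeg_le`. -/
theorem exp_sub_one_le_add_pow {m a d : ℕ} {μ : ℝ} (hm : 1 ≤ m) (hd : 0 < d) (had : a ≤ d)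
    (hμ : 0 < μ) (hlarge : 20 * m * μ ≤ d) :
    Real.exp (μ * a / d) - 1 ≤
      11 / 10 * (μ / d) * ((a - m : ℕ) + m) +
        Real.exp μ * (20 * μ / d) ^ m * ((a - m : ℕ) : ℝ) ^ m := by
  have hd' : (0 : ℝ) < d := by exact_mod_cast hd
  have hm' : (1 : ℝ) ≤ m := by exact_mod_cast hm
  set y : ℝ := ((a - m : ℕ) : ℝ) with hy
  have hy0 : 0 ≤ y := Nat.cast_nonneg _
  have hay : (a : ℝ) ≤ y + m := by
    rw [hy]; exact_mod_cast (show a ≤ a - m + m by omega)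
  have had' : (a : ℝ) ≤ d := by exact_mod_cast had
  have ha0 : (0 : ℝ) ≤ a := Nat.cast_nonneg _
  by_cases hcase : μ * a / d ≤ 1 / 10
  · have h1 := exp_sub_one_le_of_le (by positivity) hcase (by norm_num)
    have h2 : μ * a / d ≤ μ / d * (y + m) := by
      rw [mul_div_right_comm]
      exact mul_le_mul_of_nonneg_left hay (by positivity)
    have h3 : 0 ≤ Real.exp μ * (20 * μ / d) ^ m * y ^ m := by positivity
    nlinarith
  · push Not at hcase
    rw [lt_div_iff₀ hd'] at hcase
    have h1 : 1 ≤ 20 * μ / d * y := by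
      rw [div_mul_eq_mul_div, le_div_iff₀ hd']
      nlinarith
    have h2 : 1 ≤ (20 * μ / d * y) ^ m := one_le_pow₀ h1
    have h3 : Real.exp (μ * a / d) ≤ Real.exp μ := by
      apply Real.exp_le_exp.2
      rw [div_le_iff₀ hd']
      exact mul_le_mul_of_nonneg_left had' hμ.le
    have h4 : 0 ≤ 11 / 10 * (μ / d) * (y + m) := by positivity
    rw [mul_assoc (Real.exp μ), ← mul_pow]
    nlinarith [Real.exp_pos μ]

/-- The m-th moment bounds the mean by γ, which handles the linear term; `h3` makes the contribution
of large codegrees negligible. The condition 100m ≤ γ restricts the use to m ≥ 2, where γ grows with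
d. -/
theorem sum_exp_codeg_le_of_two_le {m : ℕ}
    (h : (completeBipartiteGraph (Fin s) (Fin (m + 1))).Free G)
    {N : V → Finset V} (hN : ∀ x, (∀ y ∈ N x, G.Adj x y) ∧ (N x).card = d)
    (hm : 1 ≤ m) (hd : 0 < d) {μ γ : ℝ} (hμ : 0 < μ) (hγ : 0 < γ)
    (hγm : γ ^ m = s * (d : ℝ) ^ (m - 1)) (h1 : 20 * m * μ ≤ d) (h2 : 100 * m ≤ γ)
    (h3 : Real.exp μ * s * (20 * μ) ^ m ≤ μ * γ / 100) (v p : V) :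
    ∑ x ∈ N p, (Real.exp (μ * codeg N v x / d) - 1) ≤ 4 / 3 * μ * γ := by
  have hd' : (0 : ℝ) < d := by exact_mod_cast hd
  have hm' : (1 : ℝ) ≤ m := by exact_mod_cast hm
  have hdm : (s : ℝ) * (d : ℝ) ^ m = d * γ ^ m := by
    rw [hγm]
    obtain ⟨k, rfl⟩ : ∃ k, m = k + 1 := ⟨m - 1, by omega⟩
    simp only [Nat.add_sub_cancel]
    ring
  set y : V → ℝ := fun x => ((codeg N v x - m : ℕ) : ℝ) with hy
  have hpow : ∑ x ∈ N p, y x ^ m ≤ d * γ ^ m := by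
    rw [← hdm]
    simp only [hy]
    exact_mod_cast sum_pow_le h hN v p
  have hsum : ∑ x ∈ N p, y x ≤ d * γ := by
    -- Tangent line of the m-th power at γ (Bernoulli); summed, it is the power mean inequality.
    have hpt : ∀ x ∈ N p, m * (y x - γ) ≤ γ * (y x ^ m / γ ^ m - 1) := by
      intro x _
      have hy0 : 0 ≤ y x / γ := div_nonneg (Nat.cast_nonneg _) hγ.le
      have := one_add_mul_le_pow (a := y x / γ - 1) (by linarith) m
      rw [add_sub_cancel, div_pow] at this
      have h5 := mul_le_mul_of_nonneg_left this hγ.le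
      have h6 : γ * (1 + m * (y x / γ - 1)) = γ + m * (y x - γ) := by
        field_simp
      linarith
    have := sum_le_sum hpt
    rw [← mul_sum, ← mul_sum, sum_sub_distrib, sum_sub_distrib, ← sum_div, sum_const, sum_const,
      (hN p).2, nsmul_eq_mul, nsmul_eq_mul, mul_one] at this
    have h7 : (∑ x ∈ N p, y x ^ m) / γ ^ m ≤ d := by
      rwa [div_le_iff₀ (by positivity)]
    have h8 : γ * ((∑ x ∈ N p, y x ^ m) / γ ^ m - d) ≤ 0 :=
      mul_nonpos_of_nonneg_of_nonpos hγ.le (by linarith)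
    by_contra! hlt
    nlinarith
  calc ∑ x ∈ N p, (Real.exp (μ * codeg N v x / d) - 1)
      ≤ ∑ x ∈ N p, (11 / 10 * (μ / d) * (y x + m) +
          Real.exp μ * (20 * μ / d) ^ m * y x ^ m) :=
        sum_le_sum fun x _ => exp_sub_one_le_add_pow hm hd
          (codeg_le (fun z => (hN z).2) v x) hμ h1
    _ = 11 / 10 * (μ / d) * (∑ x ∈ N p, y x + d * m) +
          Real.exp μ * (20 * μ / d) ^ m * ∑ x ∈ N p, y x ^ m := by
        rw [sum_add_distrib, ← mul_sum, ← mul_sum, sum_add_distrib, sum_const, (hN p).2,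
          nsmul_eq_mul]
    _ ≤ 11 / 10 * (μ / d) * (d * γ + d * m) +
          Real.exp μ * (20 * μ / d) ^ m * (d * γ ^ m) := by gcongr
    _ = 11 / 10 * μ * (γ + m) + Real.exp μ * s * (20 * μ) ^ m := by
        rw [← hdm, div_pow]
        field_simp
    _ ≤ 4 / 3 * μ * γ := by nlinarith [mul_pos hμ hγ]

/-- For t = 2 the typical codegree is the constant s, but then every codegree is at most s and no
moments are needed. -/
theorem sum_exp_codeg_le_of_eq_one
    (h : (completeBipartiteGraph (Fin s) (Fin 2)).Free G)
    {N : V → Finset V} (hN : ∀ x, (∀ y ∈ N x, G.Adj x y) ∧ (N x).card = d)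
    (hd : 0 < d) {μ : ℝ} (hμ : 0 < μ) (hsmall : 3 * μ * s ≤ d) (v p : V) :
    ∑ x ∈ N p, (Real.exp (μ * codeg N v x / d) - 1) ≤ 4 / 3 * μ * s := by
  classical
  have hd' : (0 : ℝ) < d := by exact_mod_cast hd
  have hcod : ∀ x, codeg N v x ≤ s := by
    intro x
    unfold codeg
    split_ifs with hx
    · exact Nat.zero_le _
    · obtain ⟨C, hC, hmem⟩ := exists_commonNeighbors h (S := {x, v}) (card_pair hx)
      refine (card_le_card fun z hz => hmem z ?_).trans hC.le
      rw [mem_inter] at hz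
      intro y hy
      rw [mem_insert, mem_singleton] at hy
      rcases hy with rfl | rfl
      · exact ((hN _).1 z hz.1).symm
      · exact ((hN _).1 z hz.2).symm
  have hpt : ∀ x ∈ N p, Real.exp (μ * codeg N v x / d) - 1 ≤ 4 / 3 * μ * s / d := by
    intro x _
    have hc : (codeg N v x : ℝ) ≤ s := by exact_mod_cast hcod x
    have h1 : μ * codeg N v x / d ≤ μ * s / d := by gcongr
    have h2 : μ * s / d ≤ 1 / 3 := by
      rw [div_le_iff₀ hd']
      linarith
    have h3 := exp_sub_one_le_of_le (z := μ * codeg N v x / d) (by positivity) (h1.trans h2)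
      (by norm_num)
    calc _ ≤ _ := h3
      _ ≤ (1 + 1 / 3) * (μ * s / d) := by gcongr
      _ = 4 / 3 * μ * s / d := by ring
  refine (sum_le_card_nsmul _ _ _ hpt).trans ?_
  rw [(hN p).2, nsmul_eq_mul]
  field_simp
  exact le_refl _

open Classical in
/-- The drift of the potential in one step of the algorithm: `c` is placed uniformly in `A`, while
its parent is at `p`; `k` is the number of children of `c`. -/
theorem sum_exp_le {N : V → Finset V} {lam b D γ : ℝ}
    (hlam : 0 < lam) (hlam' : lam ≤ 1 / 4) (hb : 0 ≤ b) (hbd : b * d = 3 * lam) (hD : 0 < D)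
    (hγ : 0 ≤ γ) {v p : V}
    (hsum : ∑ x ∈ N p, (Real.exp (b * D * codeg N v x) - 1) ≤ 4 / 3 * (b * D * d) * γ)
    {A : Finset V} (hA : A ⊆ N p) (hAd : d ≤ 2 * A.card) {k : ℕ} (hk : (k : ℝ) ≤ D) :
    ∑ x ∈ A, Real.exp ((if p ≠ v ∧ x ∈ N v then lam else 0) + k * (b * codeg N v x)) ≤
      A.card * Real.exp (b * codeg N v p + k * (4 * b * γ)) := by
  have hAd' : (d : ℝ) ≤ 2 * A.card := by exact_mod_cast hAd
  have hk0 : (0 : ℝ) ≤ k := Nat.cast_nonneg k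
  have he1 : Real.exp lam - 1 ≤ 3 / 2 * lam := by
    have := exp_sub_one_le_of_le hlam.le hlam' (by norm_num)
    linarith
  have he2 : Real.exp lam ≤ 3 / 2 := by linarith
  have he3 : 1 ≤ Real.exp lam := Real.one_le_exp hlam.le
  -- Convexity with ratio k/D reduces to the extreme case of D children; the cross term is absorbed
  -- by exp λ ≤ 3/2.
  have hpt : ∀ x ∈ A, Real.exp ((if p ≠ v ∧ x ∈ N v then lam else 0) + k * (b * codeg N v x)) ≤
      1 + 3 / 2 * lam * (if p ≠ v ∧ x ∈ N v then 1 else 0) +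
        3 / 2 * (k / D) * (Real.exp (b * D * codeg N v x) - 1) := by
    intro x _
    have h1 : Real.exp (k * (b * codeg N v x)) - 1 ≤
        k / D * (Real.exp (b * D * codeg N v x) - 1) := by
      have := exp_mul_sub_one_le (τ := k / D) (z := b * D * codeg N v x) (by positivity)
        ((div_le_one hD).2 hk)
      rwa [show (k : ℝ) / D * (b * D * codeg N v x) = k * (b * codeg N v x) by
        field_simp] at this
    have h2 : 0 ≤ Real.exp (k * (b * codeg N v x)) - 1 := by
      have := Real.one_le_exp (x := k * (b * codeg N v x)) (by positivity)
      linarith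
    rw [Real.exp_add]
    split_ifs with hx
    · nlinarith
    · rw [Real.exp_zero]
      nlinarith
  have hcount : ∑ x ∈ A, (if p ≠ v ∧ x ∈ N v then (1 : ℝ) else 0) ≤ codeg N v p := by
    rw [sum_boole]
    norm_cast
    unfold codeg
    split_ifs with hpv
    · simp [hpv]
    · refine card_le_card fun x hx => ?_
      rw [mem_filter] at hx
      exact mem_inter.2 ⟨hA hx.1, hx.2.2⟩
  have hsumA : ∑ x ∈ A, (Real.exp (b * D * codeg N v x) - 1) ≤ 4 / 3 * (b * D * d) * γ := by
    refine (sum_le_sum_of_subset_of_nonneg hA fun x _ _ => ?_).trans hsum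
    have := Real.one_le_exp (x := b * D * codeg N v x) (by positivity)
    linarith
  calc _ ≤ _ := sum_le_sum hpt
    _ = A.card + 3 / 2 * lam * ∑ x ∈ A, (if p ≠ v ∧ x ∈ N v then (1 : ℝ) else 0) +
        3 / 2 * (k / D) * ∑ x ∈ A, (Real.exp (b * D * codeg N v x) - 1) := by
      rw [sum_add_distrib, sum_add_distrib, ← mul_sum, ← mul_sum, sum_const, nsmul_eq_mul, mul_one]
    _ ≤ A.card + 3 / 2 * lam * codeg N v p +
        3 / 2 * (k / D) * (4 / 3 * (b * D * d) * γ) := by gcongr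
    -- The choices b = 3λ/d and κ = 4bγ bring out the common factor d/2, which is at most #A.
    _ = A.card + d / 2 * (b * codeg N v p + k * (4 * b * γ)) := by
      rw [show 3 / 2 * lam = b * d / 2 by linarith]
      field_simp
      ring
    _ ≤ A.card * (b * codeg N v p + k * (4 * b * γ) + 1) := by
      have : 0 ≤ b * codeg N v p + k * (4 * b * γ) := by positivity
      nlinarith
    _ ≤ _ := by
      gcongr
      exact Real.add_one_le_exp _

end Drift

/-! ### Reachable states, hits and charges -/

section State

variable {W V : Type*}

/-- A state that the algorithm can reach: a partial embedding of an initial part of the tree. -/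
structure Valid (par : W → W) (r : W) (N : V → Finset V) (f : PartialMap W V) : Prop where
  root : f r ≠ none
  inj : ∀ w w' x, f w = some x → f w' = some x → w = w'
  parent : ∀ c x, c ≠ r → f c = some x → ∃ p, f (par c) = some p ∧ x ∈ N p

/-- `c` is embedded in `N v`, but not as a child of the tree vertex at `v`. -/
def Hit (par : W → W) (N : V → Finset V) (v : V) (f : PartialMap W V) (c : W) : Prop :=
  ∃ p x, f (par c) = some p ∧ f c = some x ∧ p ≠ v ∧ x ∈ N v

open Classical in
/-- The contribution of the tree vertex `c` to the energy of `v`. -/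
noncomputable def charge (par : W → W) (N : V → Finset V) (lam b κ : ℝ) (v : V)
    (f : PartialMap W V) (c : W) : ℝ :=
  match f (par c), f c with
  | none, _ => κ
  | some p, none => b * codeg N v p
  | some p, some x => if p ≠ v ∧ x ∈ N v then lam else 0

variable {par : W → W} {r : W} {N : V → Finset V} {lam b κ : ℝ} {v : V} {f : PartialMap W V}

theorem mem_available {p x : V} :
    x ∈ available N f p ↔ x ∈ N p ∧ ∀ w, f w ≠ some x := by
  simp [available]

open Classical in
theorem ite_hit_le_charge (hb : 0 ≤ b) (hκ : 0 ≤ κ) (c : W) :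
    (if Hit par N v f c then lam else 0) ≤ charge par N lam b κ v f c := by
  unfold charge Hit
  rcases h : f (par c) with _ | p <;> rcases h' : f c with _ | x
  · simpa using hκ
  · simpa using hκ
  · simp; positivity
  · simp

open Classical in
theorem charge_le {β : ℝ} (c : W)
    (hβ : ∀ p, f (par c) = some p → b * codeg N v p ≤ β) (hβ0 : κ ≤ β) (hκ : 0 ≤ κ) :
    charge par N lam b κ v f c ≤ β + (if Hit par N v f c then lam else 0) := by
  unfold charge Hit
  rcases h : f (par c) with _ | p <;> rcases h' : f c with _ | x
  · simpa using hβ0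
  · simpa using hβ0
  · simpa using hβ p h
  · simpa using hκ.trans hβ0

open Classical

variable {c : W} {p x : V}

theorem Valid.child_none (hf : Valid par r N f) (hc : f c = none) {c' : W} (hc' : c' ≠ r)
    (h : par c' = c) : f c' = none := by
  by_contra hne
  obtain ⟨y, hy⟩ := Option.ne_none_iff_exists'.1 hne
  obtain ⟨q, hq, -⟩ := hf.parent c' y hc' hy
  rw [h, hc] at hq
  simp at hq

theorem Valid.update (hf : Valid par r N f) (hc : f c = none) (hp : f (par c) = some p)
    (hx : x ∈ available N f p) : Valid par r N (Function.update f c (some x)) := by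
  rw [mem_available] at hx
  have hne : ∀ w y, f w = some y → w ≠ c := by
    rintro w y hw rfl
    simp [hc] at hw
  refine ⟨?_, ?_, ?_⟩
  · by_cases h : r = c
    · subst h; simp
    · simpa [Function.update_of_ne h] using hf.root
  · intro w w' y hw hw'
    by_cases h : w = c <;> by_cases h' : w' = c
    · rw [h, h']
    · subst h
      rw [Function.update_self, Option.some.injEq] at hw
      rw [Function.update_of_ne h', ← hw] at hw'
      exact (hx.2 _ hw').elim
    · subst h'
      rw [Function.update_self, Option.some.injEq] at hw'
      rw [Function.update_of_ne h, ← hw'] at hw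
      exact (hx.2 _ hw).elim
    · rw [Function.update_of_ne h] at hw
      rw [Function.update_of_ne h'] at hw'
      exact hf.inj w w' y hw hw'
  · intro w y hwr hw
    by_cases h : w = c
    · subst h
      rw [Function.update_self, Option.some.injEq] at hw
      subst hw
      exact ⟨p, by rw [Function.update_of_ne (hne _ _ hp)]; exact hp, hx.1⟩
    · rw [Function.update_of_ne h] at hw
      obtain ⟨q, hq, hy⟩ := hf.parent w y hwr hw
      exact ⟨q, by rw [Function.update_of_ne (hne _ _ hq)]; exact hq, hy⟩

theorem Hit.update {c' : W} (hc : f c = none) (h : Hit par N v f c') :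
    Hit par N v (Function.update f c (some x)) c' := by
  have hne : ∀ w y, f w = some y → w ≠ c := by
    rintro w y hw rfl
    simp [hc] at hw
  obtain ⟨q, y, hq, hy, hr⟩ := h
  refine ⟨q, y, ?_, ?_, hr⟩
  · rw [Function.update_of_ne (hne _ _ hq)]; exact hq
  · rw [Function.update_of_ne (hne _ _ hy)]; exact hy

theorem Hit.of_update {c' : W} (hf : Valid par r N f) (hc : f c = none) (hc' : c' ≠ r)
    (hne : c' ≠ c) (h : Hit par N v (Function.update f c (some x)) c') : Hit par N v f c' := by
  obtain ⟨q, y, hq, hy, hr⟩ := h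
  rw [Function.update_of_ne hne] at hy
  refine ⟨q, y, ?_, hy, hr⟩
  rwa [Function.update_of_ne] at hq
  intro h
  rw [hf.child_none hc hc' h] at hy
  simp at hy

end State

/-! ### Energy, active vertices and free space -/

section FiniteState

variable {W V : Type*} [Fintype W]

open Classical in
/-- The children of `u` in the tree on `W` with root `r` and parent function `par`. -/
noncomputable def kids (par : W → W) (r u : W) : Finset W := {c | c ≠ r ∧ par c = u}

open Classical in
noncomputable def hits (par : W → W) (r : W) (N : V → Finset V) (v : V) (f : PartialMap W V) : ℕ :=
  #{c | c ≠ r ∧ Hit par N v f c}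

-- The energy prices the hits already made together with those still to be expected, so that a
-- placement trades a price for an outcome.
open Classical in
noncomputable def energy (par : W → W) (r : W) (N : V → Finset V) (lam b κ : ℝ) (v : V)
    (f : PartialMap W V) : ℝ :=
  ∑ c with c ≠ r, charge par N lam b κ v f c

/-- `v` is active once there are `t` hits or a tree vertex with codegree at least `t` to `v`. -/
def Active (par : W → W) (r : W) (N : V → Finset V) (t : ℕ) (v : V) (f : PartialMap W V) : Prop :=
  t ≤ hits par r N v f ∨ ∃ u p, f u = some p ∧ t ≤ codeg N v p

open Classical in
/-- The vertices of the graph that are occupied. -/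
noncomputable def occupied (f : PartialMap W V) : Finset V := eraseNone (univ.image f)

open Classical in
noncomputable def unembedded (f : PartialMap W V) : Finset W := {w | f w = none}

variable {par : W → W} {r : W} {N : V → Finset V} {lam b κ : ℝ} {v : V} {f : PartialMap W V}

theorem mem_kids {u c : W} : c ∈ kids par r u ↔ c ≠ r ∧ par c = u := by simp [kids]

theorem mem_occupied {x : V} : x ∈ occupied f ↔ ∃ w, f w = some x := by
  simp [occupied]

theorem mem_unembedded {w : W} : w ∈ unembedded f ↔ f w = none := by simp [unembedded]

theorem card_occupied_le : #(occupied f) ≤ Fintype.card W := by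
  classical
  calc #(occupied f) = #((occupied f).map Function.Embedding.some) := (card_map _).symm
    _ ≤ #(univ.image f) := card_le_card fun o ho => by
        obtain ⟨x, hx, rfl⟩ := mem_map.1 ho
        obtain ⟨w, hw⟩ := mem_occupied.1 hx
        exact mem_image.2 ⟨w, mem_univ _, hw⟩
    _ ≤ _ := card_image_le

theorem mul_hits_le_energy (hb : 0 ≤ b) (hκ : 0 ≤ κ) :
    lam * hits par r N v f ≤ energy par r N lam b κ v f := by
  classical
  unfold hits energy
  rw [← filter_filter, card_filter, Nat.cast_sum, mul_sum]
  refine sum_le_sum fun c _ => ?_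
  refine le_trans (le_of_eq ?_) (ite_hit_le_charge hb hκ c)
  split_ifs <;> simp

/-- As long as v is inactive, every placed parent has codegree below t with v, so its unplaced
children are charged no more than κ. -/
theorem energy_le (hb : 0 ≤ b) (hκ : 0 ≤ κ) {t : ℕ} (hbt : b * t ≤ κ)
    (hv : ¬ Active par r N t v f) :
    energy par r N lam b κ v f ≤ κ * Fintype.card W + lam * hits par r N v f := by
  classical
  unfold hits energy
  rw [← filter_filter, card_filter, Nat.cast_sum, mul_sum]
  calc _ ≤ ∑ c with c ≠ r, (κ + lam * ((if Hit par N v f c then 1 else 0 : ℕ) : ℝ)) := by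
        refine sum_le_sum fun c _ => ?_
        refine (charge_le (β := κ) c (fun p hp => ?_) le_rfl hκ).trans (le_of_eq ?_)
        · have : codeg N v p ≤ t := by
            by_contra! hlt
            exact hv (Or.inr ⟨_, p, hp, hlt.le⟩)
          have : (codeg N v p : ℝ) ≤ t := by exact_mod_cast this
          nlinarith
        · split_ifs <;> simp
    _ ≤ _ := by
        rw [sum_add_distrib, sum_const, nsmul_eq_mul, mul_comm]
        gcongr
        exact card_le_univ _

section Update

open Classical

variable {c : W} {p x : V}

/-- Only the charges of c and of its children change; the children are still unplaced because
parents are placed first. -/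
theorem energy_update (hf : Valid par r N f) (hcr : c ≠ r) (hc : f c = none)
    (hp : f (par c) = some p) :
    energy par r N lam b κ v (Function.update f c (some x)) =
      energy par r N lam b κ v f - b * codeg N v p + (if p ≠ v ∧ x ∈ N v then lam else 0) +
        #(kids par r c) * (b * codeg N v x - κ) := by
  classical
  have hpc : par c ≠ c := by
    intro h
    simp [h, hc] at hp
  have hdiff : ∀ c' ∈ ({c' | c' ≠ r} : Finset W),
      charge par N lam b κ v (Function.update f c (some x)) c' = charge par N lam b κ v f c' +
        ((if c' = c then (if p ≠ v ∧ x ∈ N v then lam else 0) - b * codeg N v p else 0) +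
        (if par c' = c then b * codeg N v x - κ else 0)) := by
    intro c' hc'
    have hc'r : c' ≠ r := by simpa using hc'
    by_cases h1 : c' = c
    · subst h1
      rw [if_pos rfl, if_neg hpc]
      simp only [charge, Function.update_of_ne hpc, Function.update_self, hc, hp]
      simp
    · by_cases h2 : par c' = c
      · have h3 := hf.child_none hc hc'r h2
        rw [if_neg h1, if_pos h2]
        simp only [charge, h2, Function.update_self, Function.update_of_ne h1, h3, hc]
        ring
      · rw [if_neg h1, if_neg h2]
        simp only [charge, Function.update_of_ne h1, Function.update_of_ne h2]
        ring
  unfold energy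
  rw [sum_congr rfl hdiff, sum_add_distrib, sum_add_distrib, sum_ite_eq' , if_pos (by simpa using hcr),
    ← sum_filter, filter_filter, sum_const, nsmul_eq_mul]
  have : kids par r c = ({c' | c' ≠ r ∧ par c' = c} : Finset W) := by
    ext; simp [kids]
  rw [this]
  ring

theorem Active.update {t : ℕ} (hc : f c = none) (h : Active par r N t v f) :
    Active par r N t v (Function.update f c (some x)) := by
  rcases h with h | ⟨u, q, hu, hq⟩
  · refine Or.inl (h.trans (card_le_card ?_))
    intro w hw
    simp only [mem_filter, mem_univ, true_and] at hw ⊢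
    exact ⟨hw.1, hw.2.update hc⟩
  · refine Or.inr ⟨u, q, ?_, hq⟩
    rw [Function.update_of_ne]
    · exact hu
    · rintro rfl
      simp [hc] at hu

/-- Either way a newly active v is a common neighbour of a t-set: x with t - 1 occupied vertices, or
t elements of N(x). This bounds the number of entries per step. -/
theorem exists_hits_of_active_update {t : ℕ} (hf : Valid par r N f) (hc : f c = none)
    (hv : ¬ Active par r N t v f) (hv' : Active par r N t v (Function.update f c (some x))) :
    (x ∈ N v ∧ ∃ S ⊆ occupied f, #S = t - 1 ∧ S ⊆ N v) ∨ t ≤ codeg N v x := by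
  classical
  rcases hv' with h | ⟨u, q, hu, hq⟩
  · left
    have hlt : hits par r N v f < t := by
      by_contra! hle
      exact hv (Or.inl hle)
    set A : Finset W := {c | c ≠ r ∧ Hit par N v f c} with hA
    have hAcard : #A = hits par r N v f := by simp [hA, hits]
    set A' : Finset W := {c' | c' ≠ r ∧ Hit par N v (Function.update f c (some x)) c'} with hA'
    have hA'card : #A' = hits par r N v (Function.update f c (some x)) := by simp [hA', hits]
    have hsub : A'.erase c ⊆ A := by
      intro w hw
      simp only [hA', hA, mem_erase, mem_filter, mem_univ, true_and] at hw ⊢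
      exact ⟨hw.2.1, hw.2.2.of_update hf hc hw.2.1 hw.1⟩
    have hcA : c ∈ A' := by
      by_contra hcA
      rw [erase_eq_of_notMem hcA] at hsub
      have := card_le_card hsub
      omega
    have hle : t - 1 ≤ #A := by
      have := card_le_card hsub
      rw [card_erase_of_mem hcA] at this
      omega
    obtain ⟨B, hB, hBcard⟩ := exists_subset_card_eq hle
    have hxv : x ∈ N v := by
      simp only [hA', mem_filter, mem_univ, true_and] at hcA
      obtain ⟨_, q, y, -, hy, -, hyv⟩ := hcA
      rw [Function.update_self, Option.some.injEq] at hy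
      exact hy ▸ hyv
    have hhit : ∀ w ∈ B, ∃ y, f w = some y ∧ y ∈ N v := by
      intro w hw
      have := hB hw
      simp only [hA, mem_filter, mem_univ, true_and] at this
      obtain ⟨-, -, y, -, hy, -, hyv⟩ := this
      exact ⟨y, hy, hyv⟩
    have : Nonempty V := ⟨x⟩
    choose! g hg hgv using hhit
    refine ⟨hxv, B.image g, ?_, ?_, ?_⟩
    · intro y hy
      obtain ⟨w, hw, rfl⟩ := mem_image.1 hy
      exact mem_occupied.2 ⟨w, hg w hw⟩
    · rw [card_image_of_injOn, hBcard]
      intro w hw w' hw' h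
      have h : g w = g w' := h
      exact hf.inj w w' (g w) (hg w hw) (h ▸ hg w' hw')
    · intro y hy
      obtain ⟨w, hw, rfl⟩ := mem_image.1 hy
      exact hgv w hw
  · right
    by_cases h : u = c
    · subst h
      rw [Function.update_self, Option.some.injEq] at hu
      rwa [hu]
    · rw [Function.update_of_ne h] at hu
      exact (hv (Or.inr ⟨u, q, hu, hq⟩)).elim

end Update

open Classical in
theorem card_unembedded_update {c : W} {x : V} (hc : f c = none) :
    #(unembedded f) = #(unembedded (Function.update f c (some x))) + 1 := by
  classical
  have : unembedded (Function.update f c (some x)) = (unembedded f).erase c := by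
    ext w
    rw [mem_erase, mem_unembedded, mem_unembedded]
    by_cases h : w = c
    · subst h; simp
    · simp [h]
  rw [this, card_erase_add_one (mem_unembedded.2 hc)]

/-- If `N p` has few hits, then most of it is available to the tree vertex at `p`. -/
theorem card_le_card_available_add (hf : Valid par r N f) {u : W} {p : V} (hu : f u = some p) :
    #(N p) ≤ #(available N f p) + (hits par r N p f + #(kids par r u) + 1) := by
  classical
  have hsplit : N p ⊆ available N f p ∪ (N p ∩ occupied f) := by
    intro x hx
    by_cases h : x ∈ occupied f
    · exact mem_union_right _ (mem_inter.2 ⟨hx, h⟩)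
    · exact mem_union_left _ (mem_available.2 ⟨hx, fun w hw => h (mem_occupied.2 ⟨w, hw⟩)⟩)
  refine (card_le_card hsplit).trans ((card_union_le _ _).trans ?_)
  gcongr
  set A : Finset W := {c | c ≠ r ∧ Hit par N p f c} with hA
  have hAcard : #A = hits par r N p f := by simp [hA, hits]
  -- An occupant of N(p) is a hit of p, a child of u, or the root, which has no parent and accounts
  -- for the 1.
  have hmem : (N p ∩ occupied f).map Function.Embedding.some ⊆
      ((A ∪ kids par r u) ∪ {r}).image f := by
    intro o ho
    obtain ⟨x, hx, rfl⟩ := mem_map.1 ho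
    rw [mem_inter, mem_occupied] at hx
    obtain ⟨hxp, w, hw⟩ := hx
    refine mem_image.2 ⟨w, ?_, hw⟩
    by_cases hwr : w = r
    · simp [hwr]
    refine mem_union_left _ ?_
    obtain ⟨q, hq, -⟩ := hf.parent w x hwr hw
    by_cases hqp : q = p
    · subst hqp
      exact mem_union_right _ (mem_kids.2 ⟨hwr, hf.inj _ _ _ hq hu⟩)
    · refine mem_union_left _ ?_
      simp only [hA, mem_filter, mem_univ, true_and]
      exact ⟨hwr, q, x, hq, hw, hqp, hxp⟩
  have h1 := card_le_card hmem
  rw [card_map] at h1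
  have h2 := card_union_le (A ∪ kids par r u) {r}
  have h3 := card_union_le A (kids par r u)
  have h4 : #(((A ∪ kids par r u) ∪ {r}).image f) ≤ _ := card_image_le
  rw [card_singleton] at h2
  omega

end FiniteState

/-! ### The potential is a supermartingale -/

section Potential

variable {W V : Type*} [Fintype W]

open Classical in
/-- The numerical conditions under which the potential is a supermartingale. -/
structure Tame (par : W → W) (r : W) (N : V → Finset V) (lam b κ D H : ℝ) (t d M : ℕ) : Prop where
  lam_nonneg : 0 ≤ lam
  b_nonneg : 0 ≤ b
  κ_nonneg : 0 ≤ κ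
  card_eq : ∀ v, #(N v) = d
  card_kids : ∀ u, (#(kids par r u) : ℝ) ≤ D
  drift : ∀ v p A, A ⊆ N p → d ≤ 2 * #A → ∀ k : ℕ, (k : ℝ) ≤ D →
    ∑ x ∈ A, Real.exp ((if p ≠ v ∧ x ∈ N v then lam else 0) + k * (b * codeg N v x)) ≤
      #A * Real.exp (b * codeg N v p + k * κ)
  entry : ∀ (O : Finset V) (x : V), #O ≤ Fintype.card W → x ∉ O → ∃ B : Finset V, #B ≤ M ∧
    ∀ v, (x ∈ N v ∧ ∃ S ⊆ O, #S = t - 1 ∧ S ⊆ N v) ∨ t ≤ codeg N v x → v ∈ B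
  b_mul_le : b * t ≤ κ
  one_le : 1 ≤ t
  le_threshold : t ≤ H
  room : 2 * (H + D + 1) ≤ d

/-- A bound for `exp` of the energy of a vertex that has just become active. -/
noncomputable def entryWeight (n : ℕ) (lam b κ D : ℝ) (t d : ℕ) : ℝ :=
  Real.exp (κ * n + lam * t + D * (b * d))

open Classical in
noncomputable def weight (par : W → W) (r : W) (N : V → Finset V) (lam b κ : ℝ) (t : ℕ)
    (f : PartialMap W V) (v : V) : ℝ≥0∞ :=
  if Active par r N t v f then ENNReal.ofReal (Real.exp (energy par r N lam b κ v f)) else 0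

/-- The total weight of the active vertices, plus a reserve for those that become active later. -/
noncomputable def potential (par : W → W) (r : W) (N : V → Finset V) (lam b κ : ℝ) (t : ℕ)
    (E : ℝ≥0∞) (f : PartialMap W V) : ℝ≥0∞ :=
  ∑' v, weight par r N lam b κ t f v + E * #(unembedded f)

variable {par : W → W} {r : W} {N : V → Finset V} {lam b κ D H : ℝ} {t d M : ℕ}
  {f : PartialMap W V}

theorem Tame.half_le_card_available (h : Tame par r N lam b κ D H t d M) (hf : Valid par r N f)
    {u : W} {p : V} (hu : f u = some p) (hH : (hits par r N p f : ℝ) < H) :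
    d ≤ 2 * #(available N f p) ∧ #(kids par r u) ≤ #(available N f p) := by
  have h1 := card_le_card_available_add hf hu
  rw [h.card_eq] at h1
  have h2 := h.card_kids u
  have h3 := h.room
  have h4 : (0 : ℝ) ≤ hits par r N p f := Nat.cast_nonneg _
  have h1' : (d : ℝ) ≤ #(available N f p) + (hits par r N p f + #(kids par r u) + 1) := by
    exact_mod_cast h1
  have h5 : (d : ℝ) ≤ 2 * #(available N f p) := by linarith
  refine ⟨by exact_mod_cast h5, ?_⟩
  have h6 : (#(kids par r u) : ℝ) ≤ #(available N f p) := by linarith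
  exact_mod_cast h6

/-- Markov's inequality in the form needed for induction: in a state with H hits somewhere the
target bound is at least 1, so nothing more has to be shown from there on. -/
theorem Tame.one_le_potential (h : Tame par r N lam b κ D H t d M) {E : ℝ≥0∞} {v : V}
    (hH : H ≤ hits par r N v f) :
    1 ≤ potential par r N lam b κ t E f * (ENNReal.ofReal (Real.exp (lam * H)))⁻¹ := by
  have hact : Active par r N t v f := by
    left
    have := h.le_threshold.trans hH
    exact_mod_cast this
  have hle : ENNReal.ofReal (Real.exp (lam * H)) ≤ potential par r N lam b κ t E f := by
    calc _ ≤ weight par r N lam b κ t f v := by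
          rw [weight, if_pos hact]
          refine ENNReal.ofReal_le_ofReal (Real.exp_le_exp.2 ?_)
          exact (mul_le_mul_of_nonneg_left hH h.lam_nonneg).trans
            (mul_hits_le_energy h.b_nonneg h.κ_nonneg)
      _ ≤ ∑' v, weight par r N lam b κ t f v := ENNReal.le_tsum v
      _ ≤ _ := le_self_add
  have hpos : ENNReal.ofReal (Real.exp (lam * H)) ≠ 0 := by
    simpa using Real.exp_pos _
  rw [← ENNReal.mul_inv_cancel hpos ENNReal.ofReal_ne_top]
  gcongr

-- An active vertex obeys the drift inequality. An inactive one has at most t - 1 hits, and a single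
-- step adds at most λ + D·b·d to its energy, so it enters with at most `entryWeight`.
open Classical in
theorem Tame.sum_weight_le (h : Tame par r N lam b κ D H t d M) (hf : Valid par r N f)
    {c : W} {p : V} (hcr : c ≠ r) (hc : f c = none) (hp : f (par c) = some p)
    {A : Finset V} (hA : A ⊆ N p) (hAd : d ≤ 2 * #A) (v : V) :
    ∑ x ∈ A, weight par r N lam b κ t (Function.update f c (some x)) v ≤
      #A * weight par r N lam b κ t f v + ∑ x ∈ A,
        if ¬ Active par r N t v f ∧ Active par r N t v (Function.update f c (some x)) then
          ENNReal.ofReal (entryWeight (Fintype.card W) lam b κ D t d) else 0 := by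
  by_cases hv : Active par r N t v f
  · refine le_trans ?_ le_self_add
    have hsum := h.drift v p A hA hAd _ (h.card_kids c)
    have hmul := mul_le_mul_of_nonneg_left hsum (Real.exp_pos
      (energy par r N lam b κ v f - b * codeg N v p - #(kids par r c) * κ)).le
    rw [mul_sum, mul_left_comm, ← Real.exp_add] at hmul
    calc _ = ∑ x ∈ A, ENNReal.ofReal
          (Real.exp (energy par r N lam b κ v (Function.update f c (some x)))) := by
          refine sum_congr rfl fun x _ => ?_
          rw [weight, if_pos (hv.update hc)]
      _ = ENNReal.ofReal (∑ x ∈ A,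
          Real.exp (energy par r N lam b κ v (Function.update f c (some x)))) :=
          (ENNReal.ofReal_sum_of_nonneg fun x _ => (Real.exp_pos _).le).symm
      _ ≤ ENNReal.ofReal (#A * Real.exp (energy par r N lam b κ v f)) := by
          refine ENNReal.ofReal_le_ofReal (le_trans (le_of_eq ?_) (hmul.trans (le_of_eq ?_)))
          · refine sum_congr rfl fun x _ => ?_
            rw [← Real.exp_add, energy_update hf hcr hc hp]
            congr 1
            ring
          · congr 2
            ring
      _ = #A * weight par r N lam b κ t f v := by
          rw [ENNReal.ofReal_mul (Nat.cast_nonneg _), ENNReal.ofReal_natCast, weight, if_pos hv]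
  · refine le_trans (sum_le_sum fun x _ => ?_) le_add_self
    by_cases hv' : Active par r N t v (Function.update f c (some x))
    · rw [if_pos ⟨hv, hv'⟩, weight, if_pos hv']
      refine ENNReal.ofReal_le_ofReal (Real.exp_le_exp.2 ?_)
      have h1 := energy_le (lam := lam) h.b_nonneg h.κ_nonneg h.b_mul_le hv
      have h2 : hits par r N v f + 1 ≤ t := by
        by_contra! hlt
        exact hv (Or.inl (by omega))
      have h2' : (hits par r N v f : ℝ) + 1 ≤ t := by exact_mod_cast h2
      have h3 := mul_le_mul_of_nonneg_left h2' h.lam_nonneg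
      have h4 : (if p ≠ v ∧ x ∈ N v then lam else 0) ≤ lam := by
        split_ifs
        · exact le_rfl
        · exact h.lam_nonneg
      have h5 : (codeg N v x : ℝ) ≤ d := by exact_mod_cast codeg_le h.card_eq v x
      have h6 : #(kids par r c) * (b * codeg N v x) ≤ D * (b * d) := by
        have := h.card_kids c
        have := h.b_nonneg
        gcongr
        exact (Nat.cast_nonneg _).trans (h.card_kids c)
      have h7 : 0 ≤ b * codeg N v p := mul_nonneg h.b_nonneg (Nat.cast_nonneg _)
      have h8 : 0 ≤ #(kids par r c) * κ := mul_nonneg (Nat.cast_nonneg _) h.κ_nonneg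
      rw [energy_update hf hcr hc hp]
      linarith
    · simp [weight, hv']

open Classical in
/-- The potential does not increase on average. -/
theorem Tame.sum_potential_le (h : Tame par r N lam b κ D H t d M) (hf : Valid par r N f)
    {c : W} {p : V} (hcr : c ≠ r) (hc : f c = none) (hp : f (par c) = some p)
    (hAd : d ≤ 2 * #(available N f p)) {E : ℝ≥0∞}
    (hE : M * ENNReal.ofReal (entryWeight (Fintype.card W) lam b κ D t d) ≤ E) :
    ∑ x ∈ available N f p, potential par r N lam b κ t E (Function.update f c (some x)) ≤
      #(available N f p) * potential par r N lam b κ t E f := by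
  set A := available N f p with hA
  set Fw := ENNReal.ofReal (entryWeight (Fintype.card W) lam b κ D t d) with hFw
  have hnew : ∀ x ∈ A, ∑' v, (if ¬ Active par r N t v f ∧
      Active par r N t v (Function.update f c (some x)) then Fw else 0) ≤ E := by
    intro x hx
    have hx' := mem_available.1 hx
    have hxO : x ∉ occupied f := fun ho => by
      obtain ⟨w, hw⟩ := mem_occupied.1 ho
      exact hx'.2 w hw
    obtain ⟨B, hB, hmem⟩ := h.entry (occupied f) x card_occupied_le hxO
    refine le_trans ?_ hE
    calc _ ≤ ∑' v, (if v ∈ B then Fw else 0) := by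
          refine ENNReal.tsum_le_tsum fun v => ?_
          split_ifs with h1 h2
          · exact le_rfl
          · exact (h2 (hmem v (exists_hits_of_active_update hf hc h1.1 h1.2))).elim
          · exact zero_le
          · exact le_rfl
      _ = ∑ v ∈ B, Fw := by
          rw [tsum_eq_sum (s := B) fun v hv => if_neg hv]
          exact sum_congr rfl fun v hv => if_pos hv
      _ ≤ M * Fw := by
          rw [sum_const, nsmul_eq_mul]
          gcongr
  -- Each placement releases one share E of the reserve, which pays for the vertices that become
  -- active.
  have hunemb : ∀ x ∈ A, E * #(unembedded (Function.update f c (some x))) + E =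
      E * #(unembedded f) := by
    intro x _
    rw [card_unembedded_update (x := x) hc]
    push_cast
    ring
  calc ∑ x ∈ A, potential par r N lam b κ t E (Function.update f c (some x))
      = ∑' v, ∑ x ∈ A, weight par r N lam b κ t (Function.update f c (some x)) v +
          ∑ x ∈ A, E * #(unembedded (Function.update f c (some x))) := by
        rw [Summable.tsum_finsetSum fun _ _ => ENNReal.summable, ← sum_add_distrib]
        rfl
    _ ≤ ∑' v, (#A * weight par r N lam b κ t f v + ∑ x ∈ A,
          if ¬ Active par r N t v f ∧ Active par r N t v (Function.update f c (some x)) then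
            Fw else 0) + ∑ x ∈ A, E * #(unembedded (Function.update f c (some x))) := by
        gcongr with v
        exact h.sum_weight_le hf hcr hc hp (fun x hx => (mem_available.1 hx).1) hAd v
    _ = #A * ∑' v, weight par r N lam b κ t f v + (∑ x ∈ A, ∑' v,
          (if ¬ Active par r N t v f ∧ Active par r N t v (Function.update f c (some x)) then
            Fw else 0) + ∑ x ∈ A, E * #(unembedded (Function.update f c (some x)))) := by
        rw [ENNReal.tsum_add, ENNReal.tsum_mul_left,
          Summable.tsum_finsetSum fun _ _ => ENNReal.summable, add_assoc]
    _ ≤ #A * ∑' v, weight par r N lam b κ t f v + (∑ x ∈ A, E +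
          ∑ x ∈ A, E * #(unembedded (Function.update f c (some x)))) := by
        gcongr with x hx
        exact hnew x hx
    _ = #A * potential par r N lam b κ t E f := by
        rw [← sum_add_distrib, sum_congr rfl fun x hx => by rw [add_comm, hunemb x hx], sum_const,
          nsmul_eq_mul, ← mul_add]
        rfl

end Potential

/-! ### Complete states are embeddings; incomplete ones can continue -/

section Completion

variable {W V : Type*} {par : W → W} {r : W} {N : V → Finset V}

theorem mem_success {T : SimpleGraph W} {G : SimpleGraph V} (hT : T.IsTree)
    (hpar : ∀ u c, IsChild T r u c ↔ c ≠ r ∧ par c = u) (hN : ∀ x, ∀ y ∈ N x, G.Adj x y)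
    {f : PartialMap W V} (hf : Valid par r N f) (hall : ∀ w, f w ≠ none) :
    some f ∈ Success T G := by
  choose g hg using fun w => Option.ne_none_iff_exists'.1 (hall w)
  have hchild : ∀ {a b}, IsChild T r a b → G.Adj (g a) (g b) := by
    intro a b hab
    obtain ⟨hb, rfl⟩ := (hpar _ _).1 hab
    obtain ⟨p, hp, hx⟩ := hf.parent b (g b) hb (hg b)
    rw [hg, Option.some.injEq] at hp
    exact hp ▸ hN _ _ hx
  refine ⟨⟨⟨g, fun {a b} hab => ?_⟩, fun a b hab => ?_⟩, ?_⟩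
  · rcases isChild_or_isChild (r := r) hT hab with h | h
    · exact hchild h
    · exact (hchild h).symm
  · exact hf.inj a b (g a) (hg a) ((hg b).trans (congrArg some (by exact hab.symm)))
  · congr 1
    funext w
    exact hg w

/-- If something is not embedded yet, then a vertex is pending. -/
theorem exists_pending {T : SimpleGraph W} (hT : T.IsTree)
    (hpar : ∀ u c, IsChild T r u c ↔ c ≠ r ∧ par c = u)
    {f : PartialMap W V} (hf : Valid par r N f) (hall : ¬ ∀ w, f w ≠ none) :
    ∃ u, Pending T r f u := by
  push Not at hall
  obtain ⟨w, hw⟩ := hall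
  obtain ⟨p, -, -⟩ := hT.existsUnique_path r w
  -- The walk from the root leaves the embedded part along some edge ab. There b is the child, since
  -- an embedded vertex has an embedded parent.
  obtain ⟨⟨⟨a, b⟩, hab⟩, -, ha, hb⟩ := p.exists_boundary_dart {w | f w ≠ none} hf.root (by simpa)
  simp only [Set.mem_ofPred_eq, not_not] at ha hb
  rcases isChild_or_isChild (r := r) hT hab with h | h
  · exact ⟨a, ha, b, h, hb⟩
  · obtain ⟨har, hpa⟩ := (hpar _ _).1 h
    obtain ⟨x, hx⟩ := Option.ne_none_iff_exists'.1 ha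
    obtain ⟨q, hq, -⟩ := hf.parent a x har hx
    have hpa : par a = b := hpa
    rw [hpa, hb] at hq
    simp at hq

theorem toOuterMeasure_pure_compl_success {T : SimpleGraph W} {G : SimpleGraph V} (hT : T.IsTree)
    (hpar : ∀ u c, IsChild T r u c ↔ c ≠ r ∧ par c = u) (hN : ∀ x, ∀ y ∈ N x, G.Adj x y)
    {f : PartialMap W V} (hf : Valid par r N f) (hall : ∀ w, f w ≠ none) :
    (PMF.pure (some f)).toOuterMeasure (Success T G)ᶜ = 0 := by
  classical
  rw [PMF.toOuterMeasure_pure_apply, if_neg]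
  rw [Set.mem_compl_iff, not_not]
  exact mem_success hT hpar hN hf hall

end Completion

/-! ### Failure probability against the potential -/

section Failure

variable {W V : Type*} [Fintype W] {par : W → W} {r : W} {N : V → Finset V}
  {lam b κ D H : ℝ} {t d M : ℕ}

theorem toOuterMeasure_le_one {α : Type*} (p : PMF α) (s : Set α) : p.toOuterMeasure s ≤ 1 := by
  rw [PMF.toOuterMeasure_apply, ← p.tsum_coe]
  exact ENNReal.tsum_le_tsum fun a => Set.indicator_le_self _ _ _

theorem toOuterMeasure_uniformOfFinset_bind {α β : Type*} {A : Finset α} (hA : A.Nonempty)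
    (K : α → PMF β) (s : Set β) :
    ((PMF.uniformOfFinset A hA).bind K).toOuterMeasure s =
      (#A : ℝ≥0∞)⁻¹ * ∑ x ∈ A, (K x).toOuterMeasure s := by
  rw [PMF.toOuterMeasure_bind_apply, tsum_eq_sum (s := A), mul_sum]
  · refine sum_congr rfl fun x hx => ?_
    rw [PMF.uniformOfFinset_apply_of_mem hA hx]
  · intro x hx
    rw [PMF.uniformOfFinset_apply_of_notMem hA hx, zero_mul]

open Classical in
/-- Embedding a list of children keeps the failure probability below the potential, provided that
this holds for what comes afterwards. -/
theorem Tame.embedList_le (h : Tame par r N lam b κ D H t d M) {E : ℝ≥0∞}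
    (hE : M * ENNReal.ofReal (entryWeight (Fintype.card W) lam b κ D t d) ≤ E)
    (hd : 0 < d) {s : Set (Option (PartialMap W V))}
    (K : Option (PartialMap W V) → PMF (Option (PartialMap W V))) {u : W} {p : V}
    (cs : List W) (f : PartialMap W V) (hcs : cs.Nodup) (hkids : ∀ c ∈ cs, c ∈ kids par r u)
    (hnone : ∀ c ∈ cs, f c = none) (hu : f u = some p) (hf : Valid par r N f)
    (hK : ∀ f', Valid par r N f' → (∀ c ∈ cs, f' c ≠ none) → (∀ c ∉ cs, f' c = f c) →
      (K (some f')).toOuterMeasure s ≤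
        potential par r N lam b κ t E f' * (ENNReal.ofReal (Real.exp (lam * H)))⁻¹) :
    ((embedList N p cs f).bind K).toOuterMeasure s ≤
      potential par r N lam b κ t E f * (ENNReal.ofReal (Real.exp (lam * H)))⁻¹ := by
  induction cs generalizing f with
  | nil =>
    rw [embedList, PMF.pure_bind]
    exact hK f hf (by simp) (by simp)
  | cons c cs ih =>
    -- The threshold may be crossed in the middle of a round, so it is tested at each placement.
    by_cases hbad : H ≤ hits par r N p f
    · exact (toOuterMeasure_le_one _ _).trans (h.one_le_potential hbad)
    push Not at hbad
    have hhalf := (h.half_le_card_available hf hu hbad).1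
    have hne : (available N f p).Nonempty := by
      rw [← card_pos]
      omega
    obtain ⟨hcr, hcu⟩ := mem_kids.1 (hkids c (by simp))
    have hc : f c = none := hnone c (by simp)
    have hpc : f (par c) = some p := by rw [hcu, hu]
    have hcard : (#(available N f p) : ℝ≥0∞) ≠ 0 := by
      exact_mod_cast (card_pos.2 hne).ne'
    rw [embedList, dif_pos hne, PMF.bind_bind, toOuterMeasure_uniformOfFinset_bind]
    calc _ ≤ (#(available N f p) : ℝ≥0∞)⁻¹ * ∑ x ∈ available N f p,
          potential par r N lam b κ t E (Function.update f c (some x)) *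
            (ENNReal.ofReal (Real.exp (lam * H)))⁻¹ := by
          gcongr with x hx
          have hnotin : c ∉ cs := (List.nodup_cons.1 hcs).1
          have huc : u ≠ c := by
            rintro rfl
            simp [hc] at hu
          refine ih _ (List.nodup_cons.1 hcs).2 (fun c' hc' => hkids c' (by simp [hc'])) ?_ ?_
            (hf.update hc hpc hx) ?_
          · intro c' hc'
            rw [Function.update_of_ne (by rintro rfl; exact hnotin hc')]
            exact hnone c' (by simp [hc'])
          · rw [Function.update_of_ne huc, hu]
          · intro f' hf' h1 h2
            refine hK f' hf' ?_ ?_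
            · intro c' hc'
              rcases List.mem_cons.1 hc' with rfl | hc'
              · rw [h2 _ hnotin, Function.update_self]
                simp
              · exact h1 c' hc'
            · intro c' hc'
              rw [List.mem_cons, not_or] at hc'
              rw [h2 c' hc'.2, Function.update_of_ne hc'.1]
      _ ≤ (#(available N f p) : ℝ≥0∞)⁻¹ * (#(available N f p) *
          potential par r N lam b κ t E f * (ENNReal.ofReal (Real.exp (lam * H)))⁻¹) := by
          rw [← sum_mul]
          gcongr
          exact h.sum_potential_le hf hcr hc hpc hhalf hE
      _ = _ := by
          rw [← mul_assoc, ← mul_assoc,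
            ENNReal.inv_mul_cancel hcard (ENNReal.natCast_ne_top _), one_mul]

-- With fewer than H hits everywhere the next round has enough room, so a bad outcome is preceded by
-- a crossing of H. `hsib` records that siblings are placed together, so that all children of the
-- chosen vertex are still unplaced. Each round places at least one vertex, hence n rounds suffice.
open Classical in
theorem Tame.rounds_le (h : Tame par r N lam b κ D H t d M) {E : ℝ≥0∞}
    (hE : M * ENNReal.ofReal (entryWeight (Fintype.card W) lam b κ D t d) ≤ E)
    (hd : 0 < d) {T : SimpleGraph W} {G : SimpleGraph V} (hT : T.IsTree)
    (hpar : ∀ u c, IsChild T r u c ↔ c ≠ r ∧ par c = u) (hN : ∀ x, ∀ y ∈ N x, G.Adj x y)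
    (σ : Schedule T r V) (n : ℕ) (f : PartialMap W V) (hf : Valid par r N f)
    (hsib : ∀ c c', c ≠ r → c' ≠ r → par c = par c' → f c = none → f c' = none)
    (hn : #(unembedded f) ≤ n) :
    (rounds σ N n f).toOuterMeasure (Success T G)ᶜ ≤
      potential par r N lam b κ t E f * (ENNReal.ofReal (Real.exp (lam * H)))⁻¹ := by
  induction n generalizing f with
  | zero =>
    rw [rounds]
    refine (toOuterMeasure_pure_compl_success hT hpar hN hf fun w hw => ?_).le.trans zero_le
    have := card_pos.2 ⟨w, mem_unembedded.2 hw⟩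
    omega
  | succ n ih =>
    rw [rounds]
    split_ifs with hall
    · exact (toOuterMeasure_pure_compl_success hT hpar hN hf hall).le.trans zero_le
    by_cases hbad : ∃ v, H ≤ hits par r N v f
    · obtain ⟨v, hv⟩ := hbad
      exact (toOuterMeasure_le_one _ _).trans (h.one_le_potential hv)
    push Not at hbad
    obtain ⟨hu, c, hcu, hc⟩ := σ.next_pending f (exists_pending hT hpar hf hall)
    set u := σ.next f with hudef
    obtain ⟨p, hp⟩ := Option.ne_none_iff_exists'.1 hu
    have hmem : ∀ c, c ∈ σ.children u ↔ c ∈ kids par r u := fun c => by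
      rw [σ.mem_children, hpar, mem_kids]
    have hlen : (σ.children u).length ≤ #(available N f p) := by
      refine le_trans (le_of_eq ?_) (h.half_le_card_available hf hp (hbad p)).2
      rw [← List.toFinset_card_of_nodup (σ.children_nodup u)]
      congr 1
      ext c
      rw [List.mem_toFinset, hmem]
    have hembed : embedChildren σ N u f = embedList N p (σ.children u) f := by
      unfold embedChildren
      simp only [hp]
      rw [if_pos hlen]
    obtain ⟨hcr, hcpar⟩ := (hpar _ _).1 hcu
    rw [hembed]
    refine h.embedList_le hE hd _ (σ.children u) f (σ.children_nodup u) (fun c => (hmem c).1) ?_ hp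
      hf ?_
    · intro c' hc'
      obtain ⟨hc'r, hc'par⟩ := mem_kids.1 ((hmem c').1 hc')
      exact hsib c c' hcr hc'r (hcpar.trans hc'par.symm) hc
    · intro f' hf' h1 h2
      refine ih f' hf' ?_ ?_
      · intro a a' ha ha' hpa hnone
        have hmem' : ∀ a, a ≠ r → (a ∈ σ.children u ↔ par a = u) := fun a ha => by
          rw [hmem, mem_kids, and_iff_right ha]
        have haN : a ∉ σ.children u := fun hin => h1 a hin hnone
        have ha'N : a' ∉ σ.children u := by
          rw [hmem' a' ha', ← hpa, ← hmem' a ha]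
          exact haN
        rw [h2 a' ha'N]
        rw [h2 a haN] at hnone
        exact hsib a a' ha ha' hpa hnone
      · have hsub : unembedded f' ⊆ (unembedded f).erase c := by
          intro w hw
          rw [mem_unembedded] at hw
          have hwN : w ∉ σ.children u := fun hin => h1 w hin hw
          rw [mem_erase, mem_unembedded, ← h2 w hwN]
          refine ⟨?_, hw⟩
          rintro rfl
          exact hwN ((σ.mem_children _ _).2 hcu)
        have := card_le_card hsub
        rw [card_erase_of_mem (mem_unembedded.2 hc)] at this
        omega

end Failure

/-! ### Entry counts and the initial potential -/

section Start

section Graph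

variable {V : Type*} {G : SimpleGraph V} {s m d : ℕ}

/-- A bound for the number of vertices that become active in one step. -/
theorem exists_entry (h : (completeBipartiteGraph (Fin s) (Fin (m + 1))).Free G)
    {N : V → Finset V} (hN : ∀ x, (∀ y ∈ N x, G.Adj x y) ∧ (N x).card = d) {n : ℕ}
    {O : Finset V} (hO : #O ≤ n) {x : V} (hx : x ∉ O) :
    ∃ B : Finset V, #B ≤ (n ^ m + d ^ (m + 1)) * s ∧
      ∀ v, (x ∈ N v ∧ ∃ S ⊆ O, #S = m ∧ S ⊆ N v) ∨ m + 1 ≤ codeg N v x → v ∈ B := by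
  classical
  obtain ⟨B, hB, hmem⟩ := exists_commonNeighbors_biUnion h
    ((powersetCard m O).image (insert x) ∪ powersetCard (m + 1) (N x)) (by
      intro S hS
      rcases mem_union.1 hS with hS | hS
      · obtain ⟨S', hS', rfl⟩ := mem_image.1 hS
        rw [mem_powersetCard] at hS'
        rw [card_insert_of_notMem fun hxS => hx (hS'.1 hxS), hS'.2]
      · exact (mem_powersetCard.1 hS).2)
  refine ⟨B, hB.trans (Nat.mul_le_mul_right _ ((card_union_le _ _).trans (Nat.add_le_add ?_ ?_))),
    fun v hv => ?_⟩
  · refine card_image_le.trans ?_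
    rw [card_powersetCard]
    exact (Nat.choose_le_pow _ _).trans (Nat.pow_le_pow_left hO _)
  · rw [card_powersetCard, (hN x).2]
    exact Nat.choose_le_pow _ _
  · rcases hv with ⟨hxv, S, hSO, hS, hSv⟩ | hcod
    · refine hmem (insert x S) (mem_union_left _ (mem_image.2 ⟨S, mem_powersetCard.2 ⟨hSO, hS⟩, rfl⟩))
        v fun y hy => ?_
      rcases mem_insert.1 hy with rfl | hy
      · exact (hN v).1 _ hxv
      · exact (hN v).1 _ (hSv hy)
    · have hle : m + 1 ≤ #(N x ∩ N v) := by
        unfold codeg at hcod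
        split_ifs at hcod
        · omega
        · exact hcod
      obtain ⟨S, hS, hcard⟩ := exists_subset_card_eq hle
      exact hmem S (mem_union_right _ (mem_powersetCard.2 ⟨hS.trans inter_subset_left, hcard⟩)) v
        fun y hy => (hN v).1 _ (mem_inter.1 (hS hy)).2

end Graph

open Classical in
theorem valid_start {W V : Type*} {par : W → W} {r : W} {N : V → Finset V} (x₀ : V) :
    Valid par r N (Function.update (fun _ => none) r (some x₀)) := by
  have key : ∀ w x, Function.update (fun _ => none) r (some x₀) w = some x → w = r := by
    intro w x h
    by_contra hne
    simp [Function.update_of_ne hne] at h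
  refine ⟨by simp, fun w w' x h h' => (key w x h).trans (key w' x h').symm, fun c x hc h => ?_⟩
  exact (hc (key c x h)).elim

variable {W V : Type*} [Fintype W] {G : SimpleGraph V} {par : W → W} {r : W} {N : V → Finset V}
  {lam b κ D H : ℝ} {t d M : ℕ}

-- The root at x₀ can already activate vertices through their codegree with x₀. They cost one
-- further share of E, hence the + 1.
open Classical in
theorem Tame.potential_start_le (h : Tame par r N lam b κ D H t d M) {E : ℝ≥0∞}
    (hE : M * ENNReal.ofReal (entryWeight (Fintype.card W) lam b κ D t d) ≤ E) (x₀ : V) :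
    potential par r N lam b κ t E (Function.update (fun _ => none) r (some x₀)) ≤
      E * (Fintype.card W + 1 : ℕ) := by
  set f : PartialMap W V := Function.update (fun _ => none) r (some x₀) with hf
  have hne : ∀ w, w ≠ r → f w = none := fun w hw => by simp [hf, hw]
  have hr : f r = some x₀ := by simp [hf]
  obtain ⟨B, hB, hmem⟩ := h.entry ∅ x₀ (by simp) (by simp)
  have hact : ∀ v, Active par r N t v f → v ∈ B := by
    rintro v (hv | ⟨u, q, hu, hq⟩)
    · have : hits par r N v f = 0 := by
        refine card_eq_zero.2 (filter_eq_empty_iff.2 ?_)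
        rintro c - ⟨hc, p, x, -, hx, -⟩
        simp [hne c hc] at hx
      have := h.one_le
      omega
    · refine hmem v (Or.inr ?_)
      by_cases hur : u = r
      · subst hur
        rw [hr, Option.some.injEq] at hu
        rwa [hu]
      · simp [hne u hur] at hu
  have hweight : ∀ v, weight par r N lam b κ t f v ≤
      ENNReal.ofReal (entryWeight (Fintype.card W) lam b κ D t d) := by
    intro v
    unfold weight
    split_ifs
    swap
    · exact zero_le
    refine ENNReal.ofReal_le_ofReal (Real.exp_le_exp.2 ?_)
    have hκ := h.κ_nonneg
    have hb := h.b_nonneg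
    have hpt : ∀ c ∈ ({c | c ≠ r} : Finset W), charge par N lam b κ v f c ≤
        κ + (if par c = r then b * d else 0) := by
      intro c hc
      have hcr : c ≠ r := by simpa using hc
      by_cases hpc : par c = r
      · have : (codeg N v x₀ : ℝ) ≤ d := by exact_mod_cast codeg_le h.card_eq v x₀
        have := mul_le_mul_of_nonneg_left this hb
        simp only [charge, hpc, hr, hne c hcr, if_true]
        linarith
      · simp [charge, hne _ hpc, hpc]
    calc energy par r N lam b κ v f ≤ _ := sum_le_sum hpt
      _ = #({c | c ≠ r} : Finset W) * κ + #(kids par r r) * (b * d) := by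
        rw [sum_add_distrib, sum_const, ← sum_filter, filter_filter, sum_const, nsmul_eq_mul,
          nsmul_eq_mul]
        rfl
      _ ≤ Fintype.card W * κ + D * (b * d) := by
        gcongr
        · exact card_le_univ _
        · exact h.card_kids r
      _ ≤ _ := by
        have := mul_nonneg h.lam_nonneg (Nat.cast_nonneg (α := ℝ) t)
        linarith
  calc potential par r N lam b κ t E f
      ≤ ∑ v ∈ B, ENNReal.ofReal (entryWeight (Fintype.card W) lam b κ D t d) +
          E * #(unembedded f) := by
        unfold potential
        rw [tsum_eq_sum (s := B) fun v hv => by rw [weight, if_neg fun ha => hv (hact v ha)]]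
        gcongr with v
        exact hweight v
    _ ≤ E + E * Fintype.card W := by
        rw [sum_const, nsmul_eq_mul]
        gcongr
        · exact le_trans (by gcongr) hE
        · exact card_le_univ _
    _ = _ := by push_cast; ring

open Classical in
/-- The failure probability of the algorithm. -/
theorem Tame.algorithm_le (h : Tame par r N lam b κ D H t d M) (hd : 0 < d)
    {T : SimpleGraph W} (hT : T.IsTree)
    (hpar : ∀ u c, IsChild T r u c ↔ c ≠ r ∧ par c = u) (hN : ∀ x, ∀ y ∈ N x, G.Adj x y)
    (σ : Schedule T r V) (x₀ : V) :
    (algorithm σ N x₀).toOuterMeasure (Success T G)ᶜ ≤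
      ENNReal.ofReal (M * (Fintype.card W + 1) *
        Real.exp (κ * Fintype.card W + lam * t + D * (b * d) - lam * H)) := by
  have hstart := h.potential_start_le (E := _) le_rfl x₀
  refine (h.rounds_le le_rfl hd hT hpar hN σ _ _ (valid_start x₀) ?_ (card_le_univ _)).trans ?_
  · intro c c' _ hc' _ _
    simp [Function.update_of_ne hc']
  · refine (mul_le_mul_left hstart _).trans (le_of_eq ?_)
    rw [Real.exp_sub, ENNReal.ofReal_mul (by positivity), ENNReal.ofReal_mul (by positivity),
      ENNReal.ofReal_div_of_pos (Real.exp_pos _), div_eq_mul_inv, ENNReal.ofReal_natCast,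
      ENNReal.ofReal_add (Nat.cast_nonneg _) zero_le_one, ENNReal.ofReal_natCast,
      ENNReal.ofReal_one, entryWeight]
    push_cast
    ring

theorem ofReal_one_sub_le_toOuterMeasure {α : Type*} (p : PMF α) (S : Set α) {ε : ℝ}
    (hε : 0 ≤ ε) (h : p.toOuterMeasure Sᶜ ≤ ENNReal.ofReal ε) : ENNReal.ofReal (1 - ε) ≤ p.toOuterMeasure S := by
  have hadd : p.toOuterMeasure S + p.toOuterMeasure Sᶜ = 1 := by
    rw [PMF.toOuterMeasure_apply, PMF.toOuterMeasure_apply, ← ENNReal.tsum_add, ← p.tsum_coe]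
    refine tsum_congr fun a => ?_
    rw [← Pi.add_apply, Set.indicator_self_add_compl]
  rw [ENNReal.ofReal_sub _ hε, ENNReal.ofReal_one]
  refine tsub_le_iff_right.2 ?_
  rw [← hadd]
  gcongr

end Start

/-! ### Conditions on large d -/

section Asymptotics

open Filter

theorem eventually_mul_pow_le_exp (C : ℝ) (k : ℕ) {c : ℝ} (hc : 0 < c) :
    ∀ᶠ x : ℝ in atTop, C * x ^ k ≤ Real.exp (c * x) := by
  have h := isLittleO_pow_exp_pos_mul_atTop k hc
  have h' := h.bound (c := (|C| + 1)⁻¹) (by positivity)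
  filter_upwards [h', eventually_ge_atTop 0] with x hx hx0
  rw [Real.norm_of_nonneg (by positivity), Real.norm_of_nonneg (Real.exp_pos _).le,
    inv_mul_eq_div, le_div_iff₀ (by positivity)] at hx
  have : 0 ≤ x ^ k := by positivity
  nlinarith [le_abs_self C]

/-- How large the logarithm `x` of the degree has to be. -/
structure Large (s m : ℕ) (ε x : ℝ) : Prop where
  one_le : 1 ≤ x
  linear : 32 * (s * (m + 1)) * x ≤ Real.exp x
  const : 128 * (m + 1) ≤ Real.exp (1 / 2 * x)
  poly : 300 * s * (15 / 2) ^ m * x ^ m ≤ Real.exp (1 / 8 * x)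
  prob : 2 * s * Real.exp (3 + m) / ε ≤ Real.exp (3 / 8 * x)

theorem eventually_large (s m : ℕ) (ε : ℝ) : ∀ᶠ x in atTop, Large s m ε x := by
  filter_upwards [eventually_ge_atTop 1,
    eventually_mul_pow_le_exp (32 * (s * (m + 1))) 1 one_pos,
    eventually_mul_pow_le_exp (128 * (m + 1)) 0 (c := 1 / 2) (by norm_num),
    eventually_mul_pow_le_exp (300 * s * (15 / 2) ^ m) m (c := 1 / 8) (by norm_num),
    eventually_mul_pow_le_exp (2 * s * Real.exp (3 + m) / ε) 0 (c := 3 / 8) (by norm_num)]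
    with x h1 h2 h3 h4 h5
  exact ⟨h1, by simpa using h2, by simpa using h3, h4, by simpa using h5⟩

theorem exists_large (s m : ℕ) (ε : ℝ) :
    ∃ d₀ : ℕ, ∀ d : ℕ, d₀ ≤ d → 0 < d ∧ Large s m ε (Real.log d) := by
  have h := (Real.tendsto_log_atTop.comp tendsto_natCast_atTop_atTop).eventually
    (eventually_large s m ε)
  obtain ⟨d₀, hd₀⟩ := eventually_atTop.1 (h.and (eventually_gt_atTop 0))
  exact ⟨d₀, fun d hd => ⟨(hd₀ d hd).2, (hd₀ d hd).1⟩⟩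

end Asymptotics

/-! ### The typical codegree γ -/

section Gamma

variable {s m d : ℕ}

/-- The typical codegree of two vertices at distance two. -/
noncomputable def typicalCodeg (s m d : ℕ) : ℝ :=
  (s : ℝ) ^ (1 / (m : ℝ)) * (d : ℝ) ^ (1 - 1 / (m : ℝ))

theorem typicalCodeg_pos (hs : 0 < s) (hd : 0 < d) : 0 < typicalCodeg s m d := by
  unfold typicalCodeg
  positivity

theorem typicalCodeg_pow (hm : 1 ≤ m) : typicalCodeg s m d ^ m = s * (d : ℝ) ^ (m - 1) := by
  have hm' : (m : ℝ) ≠ 0 := by positivity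
  rw [typicalCodeg, mul_pow, ← Real.rpow_mul_natCast (Nat.cast_nonneg _),
    ← Real.rpow_mul_natCast (Nat.cast_nonneg _), one_div_mul_cancel hm', Real.rpow_one,
    sub_mul, one_div_mul_cancel hm', one_mul, ← Real.rpow_natCast, Nat.cast_sub hm, Nat.cast_one]

theorem typicalCodeg_le (hm : 1 ≤ m) (hs : 0 < s) (hd : 0 < d) (hsd : s ≤ d) :
    typicalCodeg s m d ≤ d := by
  rw [← pow_le_pow_iff_left₀ (typicalCodeg_pos hs hd).le (Nat.cast_nonneg _) (n := m) (by omega),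
    typicalCodeg_pow hm]
  calc (s : ℝ) * (d : ℝ) ^ (m - 1) ≤ d * (d : ℝ) ^ (m - 1) := by gcongr
    _ = _ := by rw [← pow_succ', Nat.sub_add_cancel hm]

theorem exp_half_le_typicalCodeg (hm : 2 ≤ m) (hs : 0 < s) (hd : 0 < d) :
    Real.exp (1 / 2 * Real.log d) ≤ typicalCodeg s m d := by
  have hd1 : (1 : ℝ) ≤ d := by exact_mod_cast hd
  have hs1 : (1 : ℝ) ≤ s := by exact_mod_cast hs
  have hm2 : (2 : ℝ) ≤ m := by exact_mod_cast hm
  rw [mul_comm, ← Real.rpow_def_of_pos (by positivity)]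
  calc (d : ℝ) ^ (1 / 2 : ℝ) ≤ (d : ℝ) ^ (1 - 1 / (m : ℝ)) := by
        apply Real.rpow_le_rpow_of_exponent_le hd1
        have : 1 / (m : ℝ) ≤ 1 / 2 := one_div_le_one_div_of_le (by norm_num) hm2
        linarith
    _ ≤ _ := le_mul_of_one_le_left (by positivity) (Real.one_le_rpow hs1 (by positivity))

/-- The size bound on T enters here, with n the number of edges: it is d²/64 divided by γ. -/
theorem mul_typicalCodeg_le (hm : 1 ≤ m) (hs : 0 < s) (hd : 0 < d) {n : ℝ}
    (hn : n ≤ 1 / 64 * (s : ℝ) ^ (-(1 / (m : ℝ))) * (d : ℝ) ^ (((m : ℝ) + 1) / m)) :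
    n * typicalCodeg s m d ≤ (d : ℝ) ^ 2 / 64 := by
  have hd' : (0 : ℝ) < d := by exact_mod_cast hd
  have hs' : (0 : ℝ) < s := by exact_mod_cast hs
  have hm' : (m : ℝ) ≠ 0 := by positivity
  refine (mul_le_mul_of_nonneg_right hn (typicalCodeg_pos hs hd).le).trans (le_of_eq ?_)
  have h1 : (s : ℝ) ^ (-(1 / (m : ℝ))) * (s : ℝ) ^ (1 / (m : ℝ)) = 1 := by
    rw [← Real.rpow_add hs', neg_add_cancel, Real.rpow_zero]
  have h2 : (d : ℝ) ^ (((m : ℝ) + 1) / m) * (d : ℝ) ^ (1 - 1 / (m : ℝ)) = (d : ℝ) ^ 2 := by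
    rw [← Real.rpow_add hd', ← Real.rpow_natCast]
    congr 1
    field_simp
    push_cast
    ring
  rw [typicalCodeg]
  calc _ = 1 / 64 * ((s : ℝ) ^ (-(1 / (m : ℝ))) * (s : ℝ) ^ (1 / (m : ℝ))) *
        ((d : ℝ) ^ (((m : ℝ) + 1) / m) * (d : ℝ) ^ (1 - 1 / (m : ℝ))) := by ring
    _ = _ := by rw [h1, h2]; ring

theorem one_le_typicalCodeg (hm : 1 ≤ m) (hs : 0 < s) (hd : 0 < d) :
    1 ≤ typicalCodeg s m d := by
  rw [← one_le_pow_iff_of_nonneg (typicalCodeg_pos hs hd).le (n := m) (by omega),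
    typicalCodeg_pow hm]
  have : 1 ≤ s * d ^ (m - 1) := Nat.one_le_iff_ne_zero.2 (by positivity)
  exact_mod_cast this

/-- `n` is the number of vertices of the tree. -/
theorem mul_pow_le (hm : 1 ≤ m) (hs : 0 < s) (hd : 2 ≤ d) (hsd : s ≤ d) {n : ℕ}
    (hn : ((n : ℝ) - 1) * typicalCodeg s m d ≤ (d : ℝ) ^ 2 / 64) : s * n ^ m ≤ d ^ (m + 1) := by
  have hd0 : 0 < d := by omega
  have hd' : (2 : ℝ) ≤ d := by exact_mod_cast hd
  have hγ := typicalCodeg_pos (m := m) hs hd0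
  have h1 : n * typicalCodeg s m d ≤ (d : ℝ) ^ 2 := by
    have := typicalCodeg_le hm hs hd0 hsd
    nlinarith
  have h2 : (n : ℝ) ^ m * (s * (d : ℝ) ^ (m - 1)) ≤ (d : ℝ) ^ (m + 1) * (d : ℝ) ^ (m - 1) := by
    rw [← typicalCodeg_pow hm, ← mul_pow, ← pow_add]
    refine (pow_le_pow_left₀ (by positivity) h1 m).trans (le_of_eq ?_)
    rw [← pow_mul]
    congr 1
    omega
  have h3 : (s : ℝ) * (n : ℝ) ^ m ≤ (d : ℝ) ^ (m + 1) := by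
    refine le_of_mul_le_mul_right (le_trans (le_of_eq ?_) h2) (by positivity : (0:ℝ) < d ^ (m - 1))
    ring
  exact_mod_cast h3

end Gamma

/-! ### Choice of constants and the final estimate -/

section Main

variable {V : Type*} {G : SimpleGraph V} {s m d : ℕ}

/-- The exponent 3/8 · log d equals b·D·d. Even the largest possible term d^(3/8), times a power of
log d, is beaten by γ ≥ d^(1/2) when m ≥ 2. -/
theorem sum_exp_codeg_le (h : (completeBipartiteGraph (Fin s) (Fin (m + 1))).Free G)
    {N : V → Finset V} (hN : ∀ x, (∀ y ∈ N x, G.Adj x y) ∧ (N x).card = d)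
    (hm : 1 ≤ m) (hs : 0 < s) (hd : 0 < d) {ε : ℝ} (hL : Large s m ε (Real.log d)) (v p : V) :
    ∑ x ∈ N p, (Real.exp (3 / 8 * Real.log d * codeg N v x / d) - 1) ≤
      4 / 3 * (3 / 8 * Real.log d) * typicalCodeg s m d := by
  have hd' : (0 : ℝ) < d := by exact_mod_cast hd
  have hs' : (1 : ℝ) ≤ s := by exact_mod_cast hs
  have hm' : (1 : ℝ) ≤ m := by exact_mod_cast hm
  have hx := hL.one_le
  have hlin := hL.linear
  rw [Real.exp_log hd'] at hlin
  obtain rfl | hm2 := hm.eq_or_lt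
  · have hγ : typicalCodeg s 1 d = s := by simpa using typicalCodeg_pow (s := s) (d := d) hm
    rw [hγ]
    refine sum_exp_codeg_le_of_eq_one h hN hd (by positivity) ?_ v p
    push_cast at hlin
    nlinarith
  · have hhalf := exp_half_le_typicalCodeg (s := s) hm2 hs hd
    refine sum_exp_codeg_le_of_two_le h hN hm hd (by positivity)
      (typicalCodeg_pos hs hd) (typicalCodeg_pow hm) ?_ ?_ ?_ v p
    · have : m * Real.log d ≤ s * (m + 1) * Real.log d := by
        gcongr
        nlinarith
      linarith
    · linarith [hL.const]
    · have hpoly := hL.poly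
      have h1 : Real.exp (1 / 2 * Real.log d) =
          Real.exp (3 / 8 * Real.log d) * Real.exp (1 / 8 * Real.log d) := by
        rw [← Real.exp_add]
        congr 1
        ring
      calc Real.exp (3 / 8 * Real.log d) * s * (20 * (3 / 8 * Real.log d)) ^ m
          = Real.exp (3 / 8 * Real.log d) *
              (300 * s * (15 / 2) ^ m * Real.log d ^ m) / 300 := by
            rw [← mul_assoc 20, mul_pow]
            norm_num
            ring
        _ ≤ Real.exp (3 / 8 * Real.log d) * Real.exp (1 / 8 * Real.log d) / 300 := by gcongr
        _ = Real.exp (1 / 2 * Real.log d) / 300 := by rw [h1]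
        _ ≤ typicalCodeg s m d / 300 := by gcongr
        _ ≤ _ := by nlinarith [typicalCodeg_pos (m := m) hs hd]

-- Here λ = 8t·log d/d makes λH = (31/8)·t·log d, enough to outweigh the polynomial number of
-- entries, while D = d/(64t) keeps D·b·d at (3/8)·log d.
open Classical in
theorem tame {W : Type*} [Fintype W] {par : W → W} {r : W}
    (h : (completeBipartiteGraph (Fin s) (Fin (m + 1))).Free G)
    {N : V → Finset V} (hN : ∀ x, (∀ y ∈ N x, G.Adj x y) ∧ (N x).card = d)
    (hm : 1 ≤ m) (hs : m + 1 ≤ s) (hd : 0 < d) {ε : ℝ} (hL : Large s m ε (Real.log d))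
    (hkids : ∀ u, (#(kids par r u) : ℝ) ≤ d / (64 * (m + 1))) :
    Tame par r N (8 * (m + 1) * Real.log d / d) (24 * (m + 1) * Real.log d / d ^ 2)
      (4 * (24 * (m + 1) * Real.log d / d ^ 2) * typicalCodeg s m d) (d / (64 * (m + 1)))
      (31 * d / 64) (m + 1) d ((Fintype.card W ^ m + d ^ (m + 1)) * s) := by
  have hd' : (0 : ℝ) < d := by exact_mod_cast hd
  have hs0 : 0 < s := by omega
  have hs' : ((m : ℝ) + 1) ≤ s := by exact_mod_cast hs
  have hm' : (1 : ℝ) ≤ m := by exact_mod_cast hm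
  have hx := hL.one_le
  have hlin := hL.linear
  rw [Real.exp_log hd'] at hlin
  have hγ := typicalCodeg_pos (m := m) hs0 hd
  have hconst : 128 * ((m : ℝ) + 1) ≤ d := by
    calc _ ≤ _ := hL.const
      _ ≤ Real.exp (Real.log d) := Real.exp_le_exp.2 (by linarith)
      _ = d := Real.exp_log hd'
  have hlin' : 32 * (m + 1) * Real.log d ≤ d := by
    have : (m + 1) * Real.log d ≤ s * (m + 1) * Real.log d := by
      gcongr
      nlinarith
    linarith
  refine
    { lam_nonneg := by positivity
      b_nonneg := by positivity
      κ_nonneg := by positivity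
      card_eq := fun v => (hN v).2
      card_kids := hkids
      drift := ?_
      entry := fun O x hO hx => exists_entry h hN hO hx
      b_mul_le := ?_
      one_le := by omega
      le_threshold := ?_
      room := ?_ }
  · intro v p A hA hAd k hk
    refine sum_exp_le (by positivity) ?_ (by positivity) ?_ (by positivity) hγ.le ?_ hA hAd hk
    · rw [div_le_iff₀ hd']
      linarith
    · field_simp
      ring
    · have hsum := sum_exp_codeg_le h hN hm hs0 hd hL v p
      have h1 : 24 * (m + 1) * Real.log d / d ^ 2 * (d / (64 * (m + 1))) =
          3 / 8 * Real.log d / d := by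
        field_simp
        ring
      rw [h1, div_mul_cancel₀ _ hd'.ne']
      refine le_trans (le_of_eq ?_) hsum
      refine sum_congr rfl fun x _ => ?_
      rw [div_mul_eq_mul_div]
  · have hb : 0 ≤ 24 * (m + 1) * Real.log d / d ^ 2 := by positivity
    have h4 : ((m + 1 : ℕ) : ℝ) ≤ 4 * typicalCodeg s m d := by
      push_cast
      obtain rfl | hm2 := hm.eq_or_lt
      · have := one_le_typicalCodeg hm hs0 hd
        push_cast
        linarith
      · have := exp_half_le_typicalCodeg (s := s) hm2 hs0 hd
        have := hL.const
        linarith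
    calc _ ≤ _ := mul_le_mul_of_nonneg_left h4 hb
      _ = _ := by ring
  · push_cast
    linarith
  · have : (d : ℝ) / (64 * (m + 1)) ≤ d / 128 := by
      gcongr
      linarith
    linarith

/-- The bound on the failure probability is small. -/
theorem failure_bound_le (hm : 1 ≤ m) (hs : m + 1 ≤ s) (hd : 0 < d) {ε : ℝ} (hε : 0 < ε)
    (hL : Large s m ε (Real.log d)) {n : ℕ} (hn1 : 1 ≤ n)
    (hn : ((n : ℝ) - 1) * typicalCodeg s m d ≤ (d : ℝ) ^ 2 / 64) :
    (((n ^ m + d ^ (m + 1)) * s : ℕ) : ℝ) * (n + 1) *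
      Real.exp (4 * (24 * (m + 1) * Real.log d / d ^ 2) * typicalCodeg s m d * n +
        8 * (m + 1) * Real.log d / d * (m + 1 : ℕ) +
        d / (64 * (m + 1)) * (24 * (m + 1) * Real.log d / d ^ 2 * d) -
        8 * (m + 1) * Real.log d / d * (31 * d / 64)) ≤ ε := by
  have hd' : (0 : ℝ) < d := by exact_mod_cast hd
  have hs0 : 0 < s := by omega
  have hs' : ((m : ℝ) + 1) ≤ s := by exact_mod_cast hs
  have hm' : (1 : ℝ) ≤ m := by exact_mod_cast hm
  have hn1' : (1 : ℝ) ≤ n := by exact_mod_cast hn1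
  have hx := hL.one_le
  have hlin := hL.linear
  rw [Real.exp_log hd'] at hlin
  have hγ := typicalCodeg_pos (m := m) hs0 hd
  have hγ1 := one_le_typicalCodeg hm hs0 hd
  set x := Real.log d with hxdef
  have hlin' : 32 * (m + 1) * x ≤ d := by
    have : (m + 1) * x ≤ s * (m + 1) * x := by
      gcongr
      nlinarith
    linarith
  have hsd' : (s : ℝ) ≤ d := by
    have h1 : (s : ℝ) * 1 ≤ s * ((m + 1) * x) := by
      gcongr
      nlinarith
    linarith
  have hsd : s ≤ d := by exact_mod_cast hsd'
  have hd2 : (64 : ℝ) ≤ d := by nlinarith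
  have hcount : (((n ^ m + d ^ (m + 1)) * s : ℕ) : ℝ) ≤ 2 * s * Real.exp ((m + 1) * x) := by
    have h1 := mul_pow_le hm hs0 (by omega) hsd hn
    have h2 : (n ^ m + d ^ (m + 1)) * s ≤ 2 * s * d ^ (m + 1) := by
      have := Nat.mul_le_mul_right (d ^ (m + 1)) hs0
      linarith
    have h3 : Real.exp ((m + 1) * x) = (d : ℝ) ^ (m + 1) := by
      rw [hxdef, ← Nat.cast_add_one, mul_comm, Real.exp_mul, Real.exp_log hd', Real.rpow_natCast]
    rw [h3]
    exact_mod_cast h2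
  have hn2 : (n : ℝ) + 1 ≤ Real.exp (2 * x) := by
    have h3 : Real.exp (2 * x) = (d : ℝ) ^ 2 := by
      rw [hxdef, mul_comm, Real.exp_mul, Real.exp_log hd']
      norm_num
    rw [h3]
    nlinarith
  have hexp : 4 * (24 * (m + 1) * x / d ^ 2) * typicalCodeg s m d * n +
        8 * (m + 1) * x / d * (m + 1 : ℕ) +
        d / (64 * (m + 1)) * (24 * (m + 1) * x / d ^ 2 * d) -
        8 * (m + 1) * x / d * (31 * d / 64) ≤
      3 + m - 19 / 8 * (m + 1) * x + 3 / 8 * x := by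
    have h1 : 4 * (24 * (m + 1) * x / d ^ 2) * typicalCodeg s m d * n ≤
        3 / 2 * (m + 1) * x + 3 := by
      -- The extra d accounts for n being one more than the number of edges.
      have hQ : typicalCodeg s m d * n ≤ (d : ℝ) ^ 2 / 64 + d := by
        have := typicalCodeg_le hm hs0 hd hsd
        linarith
      calc _ = 96 * (m + 1) * x / d ^ 2 * (typicalCodeg s m d * n) := by ring
        _ ≤ 96 * (m + 1) * x / d ^ 2 * ((d : ℝ) ^ 2 / 64 + d) := by gcongr
        _ = 3 / 2 * (m + 1) * x + 96 * (m + 1) * x / d := by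
          field_simp
          ring
        _ ≤ 3 / 2 * (m + 1) * x + 3 := by
          gcongr
          rw [div_le_iff₀ hd']
          linarith
    have h2 : 8 * (m + 1) * x / d * (m + 1 : ℕ) ≤ 1 / 4 * (m + 1) := by
      have : 8 * (m + 1) * x / d ≤ 1 / 4 := by
        rw [div_le_iff₀ hd']
        linarith
      push_cast
      exact mul_le_mul_of_nonneg_right this (by positivity)
    have h3 : d / (64 * (m + 1)) * (24 * (m + 1) * x / d ^ 2 * d) = 3 / 8 * x := by
      field_simp
      ring
    have h4 : 8 * (m + 1) * x / d * (31 * d / 64) = 31 / 8 * (m + 1) * x := by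
      field_simp
      ring
    rw [h3, h4]
    linarith
  calc _ ≤ 2 * s * Real.exp ((m + 1) * x) * Real.exp (2 * x) *
        Real.exp (3 + m - 19 / 8 * (m + 1) * x + 3 / 8 * x) := by gcongr
    _ = 2 * s * Real.exp (3 + m) *
        Real.exp ((m + 1) * x + 2 * x + (- 19 / 8 * (m + 1) * x + 3 / 8 * x)) := by
      rw [show 3 + m - 19 / 8 * (m + 1) * x + 3 / 8 * x =
        (3 + m) + (- 19 / 8 * (m + 1) * x + 3 / 8 * x) by ring]
      simp only [Real.exp_add]
      ring
    _ ≤ 2 * s * Real.exp (3 + m) * Real.exp (-(3 / 8 * x)) := by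
      -- With t = m + 1 the coefficient of x is t + 2 - 19t/8 + 3/8 = (19 - 11t)/8, which is at most
      -- -3/8 because t ≥ 2.
      gcongr
      nlinarith
    _ ≤ ε := by
      have := hL.prob
      rw [div_le_iff₀ hε] at this
      rw [Real.exp_neg, ← div_eq_mul_inv, div_le_iff₀ (Real.exp_pos _)]
      linarith

end Main

end TreeEmbedding

open TreeEmbedding in
theorem theorem3p1 (s t : ℕ) (ht : 2 ≤ t) (hst : t ≤ s) (ε : ℝ) (hε : 0 < ε) :
    ∃ d₀ : ℕ, ∀ d : ℕ, d₀ ≤ d →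
      ∀ (V : Type*) (G : SimpleGraph V),
        (completeBipartiteGraph (Fin s) (Fin t)).Free G →
        (∀ x : V, (d : ℕ∞) ≤ (G.neighborSet x).encard) →
      ∀ (W : Type*) [Fintype W] (T : SimpleGraph W) [DecidableRel T.Adj],
        T.IsTree →
        (T.edgeSet.ncard : ℝ) ≤
          1 / 64 * (s : ℝ) ^ (-(1 / ((t : ℝ) - 1))) * (d : ℝ) ^ ((t : ℝ) / ((t : ℝ) - 1)) →
        (T.maxDegree : ℝ) ≤ 1 / (64 * (t : ℝ)) * (d : ℝ) →
      ∀ Nplus : V → Finset V,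
        (∀ x : V, (∀ y ∈ Nplus x, G.Adj x y) ∧ (Nplus x).card = d) →
      ∀ (r : W) (x₀ : V) (σ : TreeEmbedding.Schedule T r V),
        ENNReal.ofReal (1 - ε) ≤
          (TreeEmbedding.algorithm σ Nplus x₀).toOuterMeasure (TreeEmbedding.Success T G) := by
  classical
  obtain ⟨m, rfl⟩ : ∃ m, t = m + 1 := ⟨t - 1, by omega⟩
  obtain ⟨d₀, hd₀⟩ := exists_large s m ε
  refine ⟨d₀, fun d hdd V G hfree _ W _ T _ hT hedges hdeg N hN r x₀ σ => ?_⟩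
  obtain ⟨hd, hL⟩ := hd₀ d hdd
  have hm : 1 ≤ m := by omega
  obtain ⟨par, hpar⟩ := exists_parent (r := r) hT
  have hkids : ∀ u, (#(kids par r u) : ℝ) ≤ d / (64 * (m + 1)) := by
    intro u
    have h1 : #(kids par r u) ≤ T.degree u := by
      rw [← card_neighborFinset_eq_degree]
      refine card_le_card fun c hc => ?_
      rw [mem_neighborFinset]
      exact ((hpar u c).2 (mem_kids.1 hc)).1
    have h2 : (#(kids par r u) : ℝ) ≤ T.maxDegree := by
      exact_mod_cast h1.trans (T.degree_le_maxDegree u)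
    push_cast at hdeg
    refine (h2.trans hdeg).trans (le_of_eq ?_)
    ring
  have hcard : (T.edgeSet.ncard : ℝ) = (Fintype.card W : ℝ) - 1 := by
    rw [← hT.card_edgeFinset, ← coe_edgeFinset, Set.ncard_coe_finset]
    push_cast
    ring
  have hn1 : 1 ≤ Fintype.card W := Fintype.card_pos_iff.2 ⟨r⟩
  push_cast at hedges
  rw [hcard, add_sub_cancel_right] at hedges
  refine ofReal_one_sub_le_toOuterMeasure _ _ hε.le ?_
  refine ((tame hfree hN hm hst hd hL hkids).algorithm_le hd hT hpar (fun x => (hN x).1) σ x₀).trans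
    (ENNReal.ofReal_le_ofReal ?_)
  exact failure_bound_le hm hst hd hε hL hn1 (mul_typicalCodeg_le hm (by omega) hd hedges)
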